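/- Let $p\ge 1$ and let $\Lambda=(\mathbb Z/p\mathbb Z)^2$ be the toroidal lattice. Real $p\times p$ matrices $\theta$ are indexed by $\Lambda$ (indices modulo $p$). Write $\|\theta\|_1=\sum_{v}|\theta[v]|$, $\|\theta\|_F^2=\sum_v\theta[v]^2$, and let $C(\theta)$ be the $p^2\times p^2$ matrix, indexed by $\Lambda\times\Lambda$, with $C(\theta)[a,b]=\theta[b-a]$. Let $\Theta$ be the space of the $\theta$ with $\theta[0,0]=0$ and $\theta[v]=\theta[-v]$ for all $v$; let $\Theta^+=\{\theta\in\Theta : I-C(\theta)\text{ is positive definite}\}$; let $\Theta^{\rm iso}$ be the space of the $\theta\in\Theta$ that are invariant under the group $G$ of the eight linear isometries of the square (permutation and sign changes of the two coordinates), and $\Theta^{+,\rm iso}=\Theta^+\cap\Theta^{\rm iso}$. A nonempty model is a nonempty set $m=\{v\in\Lambda\setminus\{(0,0)\} : |v|_t\le r\}$ with $r>1$, where $|(i,j)|_t^2=\min(i,p-i)^2+\min(j,p-j)^2$ for representatives $0\le i,j<p$; $\Theta_m$, $\Theta_m^{\rm iso}$ are the subspaces of $\Theta$, $\Theta^{\rm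 iso}$ of elements supported in $m$, and $\Theta_m^+=\Theta_m\cap\Theta^+$. Fix $\rho_1\ge 2$ and let $\Theta^+_{m,\rho_1}$ be the set of the $\theta\in\Theta_m^+$ such that the largest eigenvalue of $I-C(\theta)$ is $<\rho_1$; let $\Theta^{+,\rm iso}_{m,\rho_1}=\Theta^+_{m,\rho_1}\cap\Theta^{\rm iso}$. Let $\sigma>0$ and $\theta\in\Theta^+$, and let $\mathbf X_1,\mathbf X_2,\dots$ be i.i.d. random fields on $\Lambda$ with the law $\mathcal N(0,\Sigma)$, $\Sigma=\sigma^2(I-C(\theta))^{-1}$. For $n\geq 1$ put $$\gamma_{n,p}(\theta')=\frac1{np^2}\sum_{i=1}^n\sum_{j\in\Lambda}\Big(\mathbf X_i[j]-\sum_{l\in\Lambda\setminus\{(0,0)\}}\theta'[l]\,\mathbf X_i[j+l]\Big)^2,\qquad l(\theta_1,\theta_2)=\frac1{p^2}\operatorname{tr}\big[(C(\theta_1)-C(\theta_2))\,\Sigma\,(C(\theta_1)-C(\theta_2))\big].$$ The conditional least squares estimators $\widehat\theta_{m,\rho_1}$ and $\widehat\theta^{\rm iso}_{m,\rho_1}$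 minimize $\gamma_{n,p}$ over the closures of $\Theta^+_{m,\rho_1}$ and $\Theta^{+,\rm iso}_{m,\rho_1}$ respectively; the projections $\theta_{m,\rho_1}$ and $\theta_{m,\rho_1}^{\rm iso}$ minimize $\theta'\mapsto l(\theta',\theta)$ over the same closures. For $v\in\Lambda$ let $\Psi_v$ be the indicator matrix of $\{v,-v\}$ and $\Psi_v^{\rm iso}$ the indicator matrix of the orbit $G\cdot v$. Fix nodes $v_1,\dots,v_{d}$ such that $\Psi_k:=\Psi_{v_k}$, $k=1,\dots,d$, is a basis of $\Theta_m$, and define the $d\times d$ matrices $$V[k,l]=\operatorname{cov}_\theta\Big(\sum_{v}\Psi_k[v]X[v],\ \sum_v\Psi_l[v]X[v]\Big),\qquad \mathrm{IL}_m=\operatorname{Diag}\big(\|\Psi_k\|_F^2\big),$$ $$W[k,l]=\frac1{p^2}\operatorname{tr}\big[C(\Psi_k)(I-C(\theta_{m,\rho_1}))^2(I-C(\theta))^{-2}C(\Psi_l)\big],$$ where $X\sim\mathcal N(0,\Sigma)$. Let $m$ be a nonempty model. Then $V$ is invertible, and the following hold (the expectations being finite), with $p$, $m$, $\theta$, $\sigma$,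 $\rho_1$ fixed. 1. If $\theta\in\Theta_m^+$ and the largest eigenvalue of $I-C(\theta)$ is $<\rho_1$ (hypothesis $(\mathbb H_1)$), then $\widehat\theta_{m,\rho_1}\to\theta$ in probability as $n\to\infty$, and $$\lim_{n\to\infty}np^2\,\mathbb E_\theta\big[l(\widehat\theta_{m,\rho_1},\theta)\big]=2\sigma^4\operatorname{tr}\big[\mathrm{IL}_mV^{-1}\big].$$ 2. If $\theta\in\Theta^+$ and $\|\theta\|_1<1$ (hypothesis $(\mathbb H_2)$), then $\widehat\theta_{m,\rho_1}\to\theta_{m,\rho_1}$ in probability as $n\to\infty$, and $$\lim_{n\to\infty}np^2\,\mathbb E_\theta\big[l(\widehat\theta_{m,\rho_1},\theta_{m,\rho_1})\big]=2\sigma^4\operatorname{tr}\big[WV^{-1}\big].$$ 3. If moreover $\theta\in\Theta^{+,\rm iso}$, both results hold for $\widehat\theta_{m,\rho_1}^{\rm iso}$, with $\theta_{m,\rho_1}$ replaced by $\theta^{\rm iso}_{m,\rho_1}$ and $V,W,\mathrm{IL}_m$ replaced by the matrices $V^{\rm iso},W^{\rm iso},\mathrm{IL}_m^{\rm iso}$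 defined in the same way from any nodes $v_1,\dots,v_{d}$ for which $(\Psi^{\rm iso}_{v_k})_{k\le d}$ is a basis of $\Theta_m^{\rm iso}$. -/

import Mathlib

open MeasureTheory ProbabilityTheory Filter Topology

namespace GMRF

/-- The toroidal lattice of size `p × p`; nodes are taken modulo `p`. -/
abbrev Torus (p : ℕ) : Type := ZMod p × ZMod p

/-- The `p × p` real arrays `θ[i,j]` with indices taken modulo `p`. -/
abbrev Param (p : ℕ) : Type := Torus p → ℝ

/-- The realisations of a random field on the torus. -/
abbrev Field (p : ℕ) : Type := EuclideanSpace ℝ (Torus p)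

/-- The eight linear isometries of the square: an optional exchange of the two coordinates,
followed by a change of sign of each coordinate. -/
abbrev SquareIsometry : Type := Bool × ℤˣ × ℤˣ

/-- The image of a node under a linear isometry of the square. -/
def SquareIsometry.act {p : ℕ} (g : SquareIsometry) (v : Torus p) : Torus p :=
  let w := if g.1 then v.swap else v
  ((((g.2.1 : ℤ) : ZMod p)) * w.1, (((g.2.2 : ℤ) : ZMod p)) * w.2)

/-- The matrix `C(θ)`, with entry `θ[b - a]` at `(a, b)`. -/
def C {p : ℕ} (θ : Param p) : Matrix (Torus p) (Torus p) ℝ :=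
  Matrix.of fun a b => θ (b - a)

/-- The space `Θ`. -/
def Theta (p : ℕ) : Submodule ℝ (Param p) where
  carrier := {θ | θ 0 = 0 ∧ ∀ v, θ v = θ (-v)}
  add_mem' := by
    rintro a b ⟨ha, ha'⟩ ⟨hb, hb'⟩
    exact ⟨by simp [ha, hb], fun v => by simp only [Pi.add_apply, ha' v, hb' v]⟩
  zero_mem' := ⟨rfl, fun _ => rfl⟩
  smul_mem' := by
    rintro c a ⟨ha, ha'⟩
    exact ⟨by simp [ha], fun v => by simp only [Pi.smul_apply, ha' v]⟩

/-- The space `Θ_m` of the elements of `Θ` whose support is included in `m`. -/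
def ThetaM {p : ℕ} (m : Set (Torus p)) : Submodule ℝ (Param p) where
  carrier := {θ | θ ∈ Theta p ∧ ∀ v, v ∉ m → θ v = 0}
  add_mem' := by
    rintro a b ⟨ha, ha'⟩ ⟨hb, hb'⟩
    exact ⟨add_mem ha hb, fun v hv => by simp [ha' v hv, hb' v hv]⟩
  zero_mem' := ⟨zero_mem _, fun _ _ => rfl⟩
  smul_mem' := by
    rintro c a ⟨ha, ha'⟩
    exact ⟨Submodule.smul_mem _ c ha, fun v hv => by simp [ha' v hv]⟩

/-- The space `Θ^iso` of the isotropic elements of `Θ`. -/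
def ThetaIso (p : ℕ) : Submodule ℝ (Param p) where
  carrier := {θ | θ ∈ Theta p ∧ ∀ (g : SquareIsometry) (v : Torus p), θ v = θ (g.act v)}
  add_mem' := by
    rintro a b ⟨ha, ha'⟩ ⟨hb, hb'⟩
    refine ⟨add_mem ha hb, fun g v => ?_⟩
    rw [Pi.add_apply, Pi.add_apply, ha' g v, hb' g v]
  zero_mem' := ⟨zero_mem _, fun _ _ => rfl⟩
  smul_mem' := by
    rintro c a ⟨ha, ha'⟩
    refine ⟨Submodule.smul_mem _ c ha, fun g v => ?_⟩
    rw [Pi.smul_apply, Pi.smul_apply, ha' g v]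

/-- The space `Θ_m^iso`. -/
def ThetaMIso {p : ℕ} (m : Set (Torus p)) : Submodule ℝ (Param p) := ThetaM m ⊓ ThetaIso p

/-- The toroidal norm of a node. -/
noncomputable def toroidalNorm {p : ℕ} (v : Torus p) : ℝ :=
  √(((min v.1.val (p - v.1.val) ^ 2 + min v.2.val (p - v.2.val) ^ 2 : ℕ) : ℝ))

/-- The collection `𝓜₁` of the neighbourhoods of the origin: balls of the toroidal norm without
their centre. -/
def models (p : ℕ) : Set (Set (Torus p)) :=
  {m | ∃ r : ℝ, 1 < r ∧ m = {v | v ≠ 0 ∧ toroidalNorm v ≤ r}}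

/-- The largest eigenvalue of a real symmetric matrix. -/
noncomputable def maxEigenvalue {ι : Type*} [Fintype ι] [DecidableEq ι] (A : Matrix ι ι ℝ) : ℝ :=
  sSup (spectrum ℝ A)

/-- The array `Ψ_v`. -/
def Psi {p : ℕ} (v : Torus p) : Param p := fun w => if w = v ∨ w = -v then 1 else 0

open Classical in
/-- The array `Ψ_v^iso`, the indicator of the orbit of `v` under the isometries of the square. -/
noncomputable def PsiIso {p : ℕ} (v : Torus p) : Param p :=
  fun w => if ∃ g : SquareIsometry, w = g.act v then 1 else 0

/-- The family `b` is a basis of the subspace `S`. -/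
def IsBasisOf {ι E : Type*} [AddCommGroup E] [Module ℝ E] (b : ι → E) (S : Submodule ℝ E) : Prop :=
  LinearIndependent ℝ b ∧ Submodule.span ℝ (Set.range b) = S

/-- A point of `S` at which `f` attains its minimum over `S` (an arbitrary point if there is
none). -/
noncomputable def argminOn {E : Type*} [Nonempty E] (f : E → ℝ) (S : Set E) : E :=
  Classical.epsilon fun x => x ∈ S ∧ IsMinOn f S x

theorem argminOn_spec {E : Type*} [Nonempty E] [TopologicalSpace E] {f : E → ℝ} {S : Set E}
    (hf : Continuous f) (hS : IsCompact S) (hne : S.Nonempty) :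
    argminOn f S ∈ S ∧ IsMinOn f S (argminOn f S) :=
  Classical.epsilon_spec (hS.exists_isMinOn hne hf.continuousOn)

section

variable {p : ℕ} [NeZero p]

/-- The set `Θ⁺`. -/
def ThetaPlus (p : ℕ) [NeZero p] : Set (Param p) :=
  {θ | θ ∈ Theta p ∧ (1 - C θ).PosDef}

/-- The set `Θ_{m,ρ}⁺`. -/
def ThetaPlusRho (m : Set (Torus p)) (ρ : ℝ) : Set (Param p) :=
  {θ | θ ∈ ThetaM m ∧ θ ∈ ThetaPlus p ∧ maxEigenvalue (1 - C θ) < ρ}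

/-- The set `Θ_{m,ρ}^{+,iso}`. -/
def ThetaPlusRhoIso (m : Set (Torus p)) (ρ : ℝ) : Set (Param p) :=
  {θ | θ ∈ ThetaMIso m ∧ θ ∈ ThetaPlus p ∧ maxEigenvalue (1 - C θ) < ρ}

/-- The covariance matrix `Σ = σ² (I - C(θ))⁻¹`. -/
noncomputable def covMatrix (σ : ℝ) (θ : Param p) : Matrix (Torus p) (Torus p) ℝ :=
  σ ^ 2 • (1 - C θ)⁻¹

/-- The law `𝒩(0, Σ)` of the field. -/
noncomputable def fieldLaw (σ : ℝ) (θ : Param p) : Measure (Field p) :=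
  multivariateGaussian 0 (covMatrix σ θ)

/-- The loss `l(θ₁, θ₂)` when the true parameters of the field are `σ` and `θ`. -/
noncomputable def loss (σ : ℝ) (θ θ₁ θ₂ : Param p) : ℝ :=
  (1 / (p : ℝ) ^ 2) * ((C θ₁ - C θ₂) * covMatrix σ θ * (C θ₁ - C θ₂)).trace

/-- The `ℓ¹` norm. -/
def l1norm (θ : Param p) : ℝ := ∑ v, |θ v|

/-- The conditional least squares criterion `γ_{n,p}(θ')` of a sample of `n` fields. -/
noncomputable def clsCriterion {n : ℕ} (x : Fin n → Field p) (θ' : Param p) : ℝ :=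
  (1 / ((n : ℝ) * (p : ℝ) ^ 2)) *
    ∑ i, ∑ j : Torus p, (x i j - ∑ l ∈ Finset.univ.erase (0 : Torus p), θ' l * x i (j + l)) ^ 2

/-- The conditional least squares estimator of the model `m`. -/
noncomputable def clsEstimator (m : Set (Torus p)) (ρ : ℝ) {n : ℕ} (x : Fin n → Field p) :
    Param p :=
  argminOn (clsCriterion x) (closure (ThetaPlusRho m ρ))

/-- The isotropic conditional least squares estimator of the model `m`. -/
noncomputable def clsEstimatorIso (m : Set (Torus p)) (ρ : ℝ) {n : ℕ} (x : Fin n → Field p) :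
    Param p :=
  argminOn (clsCriterion x) (closure (ThetaPlusRhoIso m ρ))

/-- The projection `θ_{m,ρ}`. -/
noncomputable def projection (σ : ℝ) (θ : Param p) (m : Set (Torus p)) (ρ : ℝ) : Param p :=
  argminOn (fun θ' => loss σ θ θ' θ) (closure (ThetaPlusRho m ρ))

/-- The projection `θ_{m,ρ}^iso`. -/
noncomputable def projectionIso (σ : ℝ) (θ : Param p) (m : Set (Torus p)) (ρ : ℝ) : Param p :=
  argminOn (fun θ' => loss σ θ θ' θ) (closure (ThetaPlusRhoIso m ρ))

/-- The covariance matrix under the law of the field of the random vector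
`(∑_v Ψ_k[v] X[v])_k`, where `Ψ_1, …, Ψ_d` is a family of arrays. -/
noncomputable def V (σ : ℝ) (θ : Param p) {d : ℕ} (Ψ : Fin d → Param p) :
    Matrix (Fin d) (Fin d) ℝ :=
  Matrix.of fun k l =>
    cov[fun x : Field p => ∑ v, Ψ k v * x v, fun x : Field p => ∑ v, Ψ l v * x v; fieldLaw σ θ]

/-- The matrix `W` of a family of arrays, where `θm` is the projection of `θ`. -/
noncomputable def W (θ θm : Param p) {d : ℕ} (Ψ : Fin d → Param p) : Matrix (Fin d) (Fin d) ℝ :=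
  Matrix.of fun k l =>
    (1 / (p : ℝ) ^ 2) * (C (Ψ k) * (1 - C θm) ^ 2 * ((1 - C θ)⁻¹) ^ 2 * C (Ψ l)).trace

/-- The diagonal matrix of the squared Frobenius norms of a family of arrays. -/
def IL {d : ℕ} (Ψ : Fin d → Param p) : Matrix (Fin d) (Fin d) ℝ :=
  Matrix.diagonal fun k => ∑ v, Ψ k v ^ 2

theorem abs_le_one_of_mem_thetaPlus {θ : Param p} (hθ : θ ∈ ThetaPlus p) (v : Torus p) :
    |θ v| ≤ 1 := by
  obtain ⟨⟨h0, hs⟩, hpd⟩ := hθ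
  by_cases hv : v = 0
  · simp [hv, h0]
  have hC0 : ∀ a, C θ a a = 0 := fun a => by simp [C, h0]
  have h1 : C θ 0 v = θ v := by simp [C]
  have h2 : C θ v 0 = θ v := by simp [C, ← hs v]
  have hdet := (hpd.submatrix (e := ![0, v]) (by
    have hv' : (0 : Torus p) ≠ v := fun h => hv h.symm
    intro i j hij
    fin_cases i <;> fin_cases j
    · rfl
    · exact absurd hij hv'
    · exact absurd hij hv
    · rfl)).det_pos
  rw [Matrix.det_fin_two] at hdet
  simp [hC0, h1, h2, Matrix.one_apply_ne hv, Matrix.one_apply_ne (Ne.symm hv)] at hdet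
  rw [abs_le]
  constructor <;> nlinarith

theorem isCompact_closure_of_subset_thetaPlus {S : Set (Param p)} (hS : S ⊆ ThetaPlus p) :
    IsCompact (closure S) := by
  refine (Metric.isBounded_closedBall (x := (0 : Param p)) (r := 1)).subset ?_ |>.isCompact_closure
  intro θ hθ
  rw [mem_closedBall_zero_iff, pi_norm_le_iff_of_nonneg zero_le_one]
  exact fun v => abs_le_one_of_mem_thetaPlus (hS hθ) v

theorem zero_mem_thetaPlus : (0 : Param p) ∈ ThetaPlus p :=
  ⟨zero_mem _, by
    have : C (0 : Param p) = 0 := rfl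
    rw [this, sub_zero]; exact Matrix.PosDef.one⟩

theorem maxEigenvalue_zero : maxEigenvalue (1 - C (0 : Param p)) = 1 := by
  have : C (0 : Param p) = 0 := rfl
  simp [maxEigenvalue, this]

theorem nonempty_thetaPlusRho (m : Set (Torus p)) {ρ : ℝ} (hρ : 1 < ρ) :
    (closure (ThetaPlusRho m ρ)).Nonempty :=
  ⟨0, subset_closure ⟨zero_mem _, zero_mem_thetaPlus, by rwa [maxEigenvalue_zero]⟩⟩

theorem nonempty_thetaPlusRhoIso (m : Set (Torus p)) {ρ : ℝ} (hρ : 1 < ρ) :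
    (closure (ThetaPlusRhoIso m ρ)).Nonempty :=
  ⟨0, subset_closure ⟨zero_mem _, zero_mem_thetaPlus, by rwa [maxEigenvalue_zero]⟩⟩

theorem continuous_C {q : ℕ} : Continuous (C : Param q → _) := by
  unfold C; exact continuous_pi fun a => continuous_pi fun b => continuous_apply _

theorem clsCriterion_continuous {n : ℕ} (x : Fin n → Field p) : Continuous (clsCriterion x) := by
  unfold clsCriterion
  fun_prop

theorem loss_continuous (σ : ℝ) (θ θ₂ : Param p) : Continuous (fun θ' => loss σ θ θ' θ₂) := by
  have := continuous_C (q := p)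
  unfold loss
  refine continuous_const.mul (Continuous.matrix_trace ?_)
  fun_prop

/-- The estimators and the projections are minimizers. -/
theorem clsEstimator_spec (m : Set (Torus p)) {ρ : ℝ} (hρ : 1 < ρ) {n : ℕ} (x : Fin n → Field p) :
    clsEstimator m ρ x ∈ closure (ThetaPlusRho m ρ) ∧
      IsMinOn (clsCriterion x) (closure (ThetaPlusRho m ρ)) (clsEstimator m ρ x) :=
  argminOn_spec (clsCriterion_continuous x)
    (isCompact_closure_of_subset_thetaPlus fun _ h => h.2.1) (nonempty_thetaPlusRho m hρ)

theorem clsEstimatorIso_spec (m : Set (Torus p)) {ρ : ℝ} (hρ : 1 < ρ) {n : ℕ}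
    (x : Fin n → Field p) :
    clsEstimatorIso m ρ x ∈ closure (ThetaPlusRhoIso m ρ) ∧
      IsMinOn (clsCriterion x) (closure (ThetaPlusRhoIso m ρ)) (clsEstimatorIso m ρ x) :=
  argminOn_spec (clsCriterion_continuous x)
    (isCompact_closure_of_subset_thetaPlus fun _ h => h.2.1) (nonempty_thetaPlusRhoIso m hρ)

theorem projection_spec (σ : ℝ) (θ : Param p) (m : Set (Torus p)) {ρ : ℝ} (hρ : 1 < ρ) :
    projection σ θ m ρ ∈ closure (ThetaPlusRho m ρ) ∧
      IsMinOn (fun θ' => loss σ θ θ' θ) (closure (ThetaPlusRho m ρ)) (projection σ θ m ρ) :=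
  argminOn_spec (loss_continuous σ θ θ)
    (isCompact_closure_of_subset_thetaPlus fun _ h => h.2.1) (nonempty_thetaPlusRho m hρ)

theorem projectionIso_spec (σ : ℝ) (θ : Param p) (m : Set (Torus p)) {ρ : ℝ} (hρ : 1 < ρ) :
    projectionIso σ θ m ρ ∈ closure (ThetaPlusRhoIso m ρ) ∧
      IsMinOn (fun θ' => loss σ θ θ' θ) (closure (ThetaPlusRhoIso m ρ))
        (projectionIso σ θ m ρ) :=
  argminOn_spec (loss_continuous σ θ θ)
    (isCompact_closure_of_subset_thetaPlus fun _ h => h.2.1) (nonempty_thetaPlusRhoIso m hρ)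

end

end GMRF

/-!
The criterion `clsCriterion x` is a quadratic form: at `θ'` it is the value at `unitZero p - θ'` of
the matrix `sampleGram x` of the empirical covariances, whose expectation is `Σ = covMatrix σ θ`.
Likewise the loss `l(θ₁, θ₂)` is the value of the form `Σ` at `θ₁ - θ₂`. Both estimators minimize
the criterion over the closure of `admissible S ρ`, a convex set that is relatively open in a linear
model `S`, so it is enough to treat an arbitrary `S ≤ Theta p`.

Let `t` be an admissible parameter with `δ ⬝ᵥ Σ *ᵥ (unitZero p - t) = 0` for all `δ ∈ S`: it is the
projection of `θ` (`argminOn_loss_eq`). Write `E = sampleGram x - Σ` and let `g ∈ S` be the solution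
`linearized` of `δ ⬝ᵥ Σ *ᵥ g = δ ⬝ᵥ E *ᵥ (unitZero p - t)` for all `δ ∈ S`. Since `t` is an interior
point, the estimator is close to `t + g`, and `exists_perturbation_bound` turns this into a
deterministic inequality valid for every sample: for each `ε > 0` there is `D` such that its loss
differs from the value of `Σ` at `g` by at most `ε ‖E‖² + D ‖E‖⁴` in Frobenius norm. No localization
of the estimator is needed, because the parameter set is bounded. The means of `‖E‖²` and `‖E‖⁴` are
`O(1 / n)` and `O(1 / n²)`, so that after multiplication by `n p²` only the mean of the form at `g`
remains. It is a combination, with the coefficients `V⁻¹`, of covariances of empirical covariances.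
Isserlis' formula, proved by polarization from the fourth moments of Gaussian variables, and the
commutativity of the circulant matrices identify these covariances with the entries of `W`
(`integral_bilin_gram_mul`). Consistency follows from the convergence of the risk to zero.

The estimator is an arbitrary minimizer, so its measurability has to be proved. Almost surely all
the Fourier coefficients of the field are nonzero, the criterion is strictly convex, and the
minimizer is unique; uniqueness over a compact set gives continuity on an open set of full measure.

If `θ` belongs to the model, then `t = θ`, and `W` reduces to the diagonal matrix `IL`
because the families `Ψ` are orthogonal. If `‖θ‖₁ < 1`, then `t` is the vector of the coefficients
of the best linear prediction of the value at the origin from the values in `m`. Its `ℓ¹` norm is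
less than one by a maximum principle (`exists_regression`), which makes it an interior point of the
parameter set since `2 ≤ ρ`; and it inherits the symmetries of `θ` and `m` by uniqueness
(`regression_apply_act`), which makes it symmetric, and isotropic if `θ` is.
-/

namespace GMRF

open Matrix
open scoped Pointwise

/-! ### Quadratic forms -/

section QuadraticForms

variable {ι : Type*}

theorem posDef_isSymm {M : Matrix ι ι ℝ} (hM : M.PosDef) : M.IsSymm := by
  have := hM.isHermitian
  rwa [Matrix.IsHermitian, conjTranspose_eq_transpose_of_trivial] at this

variable [Fintype ι]

/-- The squared Frobenius norm. -/
def frobSq (E : Matrix ι ι ℝ) : ℝ := ∑ v, ∑ w, E v w ^ 2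

theorem frobSq_nonneg (E : Matrix ι ι ℝ) : 0 ≤ frobSq E :=
  Finset.sum_nonneg fun _ _ => Finset.sum_nonneg fun _ _ => sq_nonneg _

theorem dotProduct_self_nonneg' (a : ι → ℝ) : 0 ≤ a ⬝ᵥ a :=
  Finset.sum_nonneg fun _ _ => mul_self_nonneg _

theorem dotProduct_sq_le (a b : ι → ℝ) : (a ⬝ᵥ b) ^ 2 ≤ (a ⬝ᵥ a) * (b ⬝ᵥ b) := by
  have h := Finset.sum_mul_sq_le_sq_mul_sq Finset.univ a b
  simpa only [dotProduct, ← sq] using h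

theorem sq_le_dotProduct_self (a : ι → ℝ) (v : ι) : a v ^ 2 ≤ a ⬝ᵥ a := by
  rw [sq]
  exact Finset.single_le_sum (f := fun i => a i * a i) (fun _ _ => mul_self_nonneg _)
    (Finset.mem_univ v)

theorem bilin_sq_le (E : Matrix ι ι ℝ) (a b : ι → ℝ) :
    (a ⬝ᵥ E *ᵥ b) ^ 2 ≤ frobSq E * (a ⬝ᵥ a) * (b ⬝ᵥ b) := by
  have h1 := dotProduct_sq_le a (E *ᵥ b)
  have h2 : (E *ᵥ b) ⬝ᵥ (E *ᵥ b) ≤ frobSq E * (b ⬝ᵥ b) := by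
    rw [frobSq, Finset.sum_mul]
    refine Finset.sum_le_sum fun v _ => ?_
    have h := dotProduct_sq_le (E v) b
    rw [sq] at h
    refine h.trans (le_of_eq ?_)
    simp [dotProduct, sq]
  have h3 := mul_le_mul_of_nonneg_left h2 (dotProduct_self_nonneg' a)
  nlinarith

theorem quad_abs_le (E : Matrix ι ι ℝ) (a : ι → ℝ) :
    |a ⬝ᵥ E *ᵥ a| ≤ √(frobSq E) * (a ⬝ᵥ a) := by
  apply abs_le_of_sq_le_sq _ (mul_nonneg (Real.sqrt_nonneg _) (dotProduct_self_nonneg' a))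
  rw [mul_pow, Real.sq_sqrt (frobSq_nonneg E)]
  nlinarith [bilin_sq_le E a a]

/-- A positive definite form dominates a multiple of the square of the Euclidean norm. -/
theorem exists_lower_bound_of_posDef {M : Matrix ι ι ℝ} (hM : M.PosDef) :
    ∃ c > 0, ∀ x : ι → ℝ, c * (x ⬝ᵥ x) ≤ x ⬝ᵥ M *ᵥ x := by
  have hpos : ∀ x : ι → ℝ, x ≠ 0 → 0 < x ⬝ᵥ M *ᵥ x := fun x hx => by
    simpa using hM.dotProduct_mulVec_pos hx
  have hK : IsCompact {x : ι → ℝ | x ⬝ᵥ x = 1} := by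
    refine Metric.isCompact_of_isClosed_isBounded ?_ ?_
    · exact isClosed_eq (by fun_prop) continuous_const
    · refine (Metric.isBounded_closedBall (x := (0 : ι → ℝ)) (r := 1)).subset fun x hx => ?_
      rw [mem_closedBall_zero_iff, pi_norm_le_iff_of_nonneg zero_le_one]
      intro v
      have h1 := sq_le_dotProduct_self x v
      rw [hx] at h1
      rw [Real.norm_eq_abs]
      exact abs_le_one_iff_mul_self_le_one.2 (by nlinarith)
  rcases Set.eq_empty_or_nonempty {x : ι → ℝ | x ⬝ᵥ x = 1} with he | hn
  · refine ⟨1, one_pos, fun x => ?_⟩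
    by_cases hx : x = 0
    · simp [hx]
    exfalso
    have hxx : 0 < x ⬝ᵥ x := by
      rcases (dotProduct_self_nonneg' x).lt_or_eq with h | h
      · exact h
      · exact absurd (dotProduct_self_eq_zero.1 h.symm) hx
    have : (√(x ⬝ᵥ x))⁻¹ • x ∈ ({x : ι → ℝ | x ⬝ᵥ x = 1} : Set _) := by
      simp only [Set.mem_ofPred_eq, smul_dotProduct, dotProduct_smul, smul_eq_mul]
      rw [← mul_assoc, ← mul_inv, Real.mul_self_sqrt hxx.le, inv_mul_cancel₀ hxx.ne']
    rw [he] at this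
    exact this
  · obtain ⟨x₀, hx₀, hmin⟩ := hK.exists_isMinOn hn
      (f := fun x : ι → ℝ => x ⬝ᵥ M *ᵥ x) (by fun_prop)
    have hx₀0 : x₀ ≠ 0 := by
      rintro rfl
      simp at hx₀
    refine ⟨x₀ ⬝ᵥ M *ᵥ x₀, hpos _ hx₀0, fun x => ?_⟩
    by_cases hx : x = 0
    · simp [hx]
    have hxx : 0 < x ⬝ᵥ x := by
      rcases (dotProduct_self_nonneg' x).lt_or_eq with h | h
      · exact h
      · exact absurd (dotProduct_self_eq_zero.1 h.symm) hx
    have hmem : (√(x ⬝ᵥ x))⁻¹ • x ∈ ({x : ι → ℝ | x ⬝ᵥ x = 1} : Set _) := by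
      simp only [Set.mem_ofPred_eq, smul_dotProduct, dotProduct_smul, smul_eq_mul]
      rw [← mul_assoc, ← mul_inv, Real.mul_self_sqrt hxx.le, inv_mul_cancel₀ hxx.ne']
    have h := hmin hmem
    simp only [mulVec_smul, smul_dotProduct, dotProduct_smul, smul_eq_mul, Set.mem_ofPred_eq] at h
    rw [← mul_assoc, ← mul_inv, Real.mul_self_sqrt hxx.le, inv_mul_eq_div, le_div_iff₀ hxx] at h
    exact h

theorem bilin_comm {M : Matrix ι ι ℝ} (hM : M.IsSymm) (a b : ι → ℝ) :
    a ⬝ᵥ M *ᵥ b = b ⬝ᵥ M *ᵥ a := by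
  conv_lhs => rw [dotProduct_mulVec, ← mulVec_transpose, hM.eq, dotProduct_comm]

theorem quad_add {M : Matrix ι ι ℝ} (hM : M.IsSymm) (a b : ι → ℝ) :
    (a + b) ⬝ᵥ M *ᵥ (a + b) = a ⬝ᵥ M *ᵥ a + 2 * (b ⬝ᵥ M *ᵥ a) + b ⬝ᵥ M *ᵥ b := by
  simp only [mulVec_add, add_dotProduct, dotProduct_add, bilin_comm hM a b]
  ring

theorem quad_sub {M : Matrix ι ι ℝ} (hM : M.IsSymm) (a b : ι → ℝ) :
    (a - b) ⬝ᵥ M *ᵥ (a - b) = a ⬝ᵥ M *ᵥ a - 2 * (b ⬝ᵥ M *ᵥ a) + b ⬝ᵥ M *ᵥ b := by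
  simp only [mulVec_sub, sub_dotProduct, dotProduct_sub, bilin_comm hM a b]
  ring

theorem posDef_quad_nonneg {M : Matrix ι ι ℝ} (hM : M.PosDef) (x : ι → ℝ) :
    0 ≤ x ⬝ᵥ M *ᵥ x := by
  simpa using hM.posSemidef.dotProduct_mulVec_nonneg x

theorem posDef_quad_pos {M : Matrix ι ι ℝ} (hM : M.PosDef) {x : ι → ℝ} (hx : x ≠ 0) :
    0 < x ⬝ᵥ M *ᵥ x := by
  simpa using hM.dotProduct_mulVec_pos hx

theorem posDef_of_quad_pos {M : Matrix ι ι ℝ} (hs : M.IsSymm)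
    (h : ∀ x : ι → ℝ, x ≠ 0 → 0 < x ⬝ᵥ M *ᵥ x) : M.PosDef := by
  refine PosDef.of_dotProduct_mulVec_pos ?_ fun x hx => by simpa using h x hx
  rwa [Matrix.IsHermitian, conjTranspose_eq_transpose_of_trivial]

/-- For a symmetric matrix, a bound on the largest eigenvalue is a positivity condition. -/
theorem maxEigenvalue_lt_iff [DecidableEq ι] [Nonempty ι] {A : Matrix ι ι ℝ} (hA : A.IsSymm)
    (ρ : ℝ) : maxEigenvalue A < ρ ↔ (algebraMap ℝ (Matrix ι ι ℝ) ρ - A).PosDef := by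
  have hA' : A.IsHermitian := by
    rwa [Matrix.IsHermitian, conjTranspose_eq_transpose_of_trivial]
  have hB : (algebraMap ℝ (Matrix ι ι ℝ) ρ - A).IsHermitian := by
    rw [Matrix.IsHermitian, conjTranspose_eq_transpose_of_trivial, transpose_sub, hA.eq,
      Matrix.algebraMap_eq_diagonal, diagonal_transpose]
  have hsp : ({ρ} : Set ℝ) - spectrum ℝ A = Set.range hB.eigenvalues := by
    rw [spectrum.singleton_sub_eq, hB.spectrum_real_eq_range_eigenvalues]
  have hne : (spectrum ℝ A).Nonempty := by
    rw [hA'.spectrum_real_eq_range_eigenvalues]; exact Set.range_nonempty _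
  have hfin : (spectrum ℝ A).Finite := by
    rw [hA'.spectrum_real_eq_range_eigenvalues]; exact Set.finite_range _
  rw [maxEigenvalue, hfin.csSup_lt_iff hne, hB.posDef_iff_eigenvalues_pos]
  constructor
  · intro h i
    have : hB.eigenvalues i ∈ ({ρ} : Set ℝ) - spectrum ℝ A := hsp ▸ Set.mem_range_self i
    rw [Set.singleton_sub] at this
    obtain ⟨x, hx, hxi⟩ := this
    have := h x hx
    simp only at hxi
    linarith
  · intro h x hx
    have : ρ - x ∈ ({ρ} : Set ℝ) - spectrum ℝ A := Set.sub_mem_sub rfl hx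
    rw [hsp] at this
    obtain ⟨i, hi⟩ := this
    linarith [h i]

end QuadraticForms

/-! ### Circulant matrices on the torus -/

section Circulant

variable {p : ℕ}

theorem C_add (a b : Param p) : C (a + b) = C a + C b := rfl

theorem C_sub (a b : Param p) : C (a - b) = C a - C b := rfl

theorem C_smul (c : ℝ) (a : Param p) : C (c • a) = c • C a := rfl

theorem C_single_zero : C (Pi.single (0 : Torus p) (1 : ℝ)) = 1 := by
  ext a b
  simp only [C, of_apply, Pi.single_apply, one_apply, sub_eq_zero, eq_comm]

theorem C_isSymm {a : Param p} (ha : ∀ v, a v = a (-v)) : (C a).IsSymm := by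
  ext v w
  simp only [C, transpose_apply, of_apply]
  rw [ha, neg_sub]

/-- A matrix on the torus that is invariant under translations. -/
def Stationary (M : Matrix (Torus p) (Torus p) ℝ) : Prop :=
  ∀ j v w, M (j + v) (j + w) = M v w

theorem stationary_one_sub_C (θ : Param p) : Stationary (1 - C θ) := fun j v w => by
  simp [C, one_apply]

variable [NeZero p]

theorem C_mul_comm (a b : Param p) : C a * C b = C b * C a := by
  ext v w
  simp only [C, mul_apply, of_apply]
  refine Fintype.sum_equiv (Equiv.subLeft (v + w)) _ _ fun x => ?_
  simp only [Equiv.subLeft_apply]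
  rw [mul_comm]
  congr 2 <;> abel

theorem C_mulVec (a : Param p) (x : Torus p → ℝ) (j : Torus p) :
    (C a *ᵥ x) j = ∑ v, a v * x (j + v) := by
  simp only [C, mulVec, dotProduct, of_apply]
  refine Fintype.sum_equiv (Equiv.subRight j) _ _ fun v => ?_
  simp

theorem card_torus : (Fintype.card (Torus p) : ℝ) = (p : ℝ) ^ 2 := by
  simp [Torus, ZMod.card, sq]

theorem Stationary.inv {M : Matrix (Torus p) (Torus p) ℝ} (hM : Stationary M) :
    Stationary M⁻¹ := fun j v w => by
  have h : M.submatrix (Equiv.addLeft j) (Equiv.addLeft j) = M := by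
    ext v w; exact hM j v w
  have h2 := Matrix.inv_submatrix_equiv M (Equiv.addLeft j) (Equiv.addLeft j)
  rw [h] at h2
  conv_rhs => rw [h2]
  rfl

theorem stationary_covMatrix (σ : ℝ) (θ : Param p) : Stationary (covMatrix σ θ) :=
  fun j v w => by
    simp only [covMatrix, Matrix.smul_apply, (stationary_one_sub_C θ).inv j v w]

theorem covMatrix_posDef {σ : ℝ} (hσ : 0 < σ) {θ : Param p} (hθ : θ ∈ ThetaPlus p) :
    (covMatrix σ θ).PosDef :=
  hθ.2.inv.smul (by positivity)

theorem trace_C_mul_C (a : Param p) {b : Param p} (hb : ∀ v, b v = b (-v))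
    {M : Matrix (Torus p) (Torus p) ℝ} (hM : Stationary M) :
    (C a * M * C b).trace = (p : ℝ) ^ 2 * (a ⬝ᵥ M *ᵥ b) := by
  have h : ∀ j, (C a * M * C b) j j = a ⬝ᵥ M *ᵥ b := fun j => by
    rw [mul_assoc, mul_apply]
    simp only [dotProduct, mulVec, mul_apply, C, of_apply]
    refine Fintype.sum_equiv (Equiv.subRight j) _ _ fun v => ?_
    simp only [Equiv.subRight_apply]
    congr 1
    refine Fintype.sum_equiv (Equiv.subRight j) _ _ fun w => ?_
    simp only [Equiv.subRight_apply]
    rw [← hM j (v - j) (w - j), add_sub_cancel, add_sub_cancel, hb (w - j), neg_sub]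
  simp only [trace, diag_apply, h, Finset.sum_const, Finset.card_univ, nsmul_eq_mul, card_torus]

end Circulant

end GMRF

namespace GMRF

open Matrix

/-! ### The set of admissible parameters -/

section Admissible

variable {p : ℕ} [NeZero p]

/-- The admissible parameters of a linear model `S`. The sets `ThetaPlusRho m ρ` and
`ThetaPlusRhoIso m ρ` are the cases `S = ThetaM m` and `S = ThetaMIso m`. -/
def admissible (S : Submodule ℝ (Param p)) (ρ : ℝ) : Set (Param p) :=
  {θ | θ ∈ S ∧ θ ∈ ThetaPlus p ∧ maxEigenvalue (1 - C θ) < ρ}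

variable {S : Submodule ℝ (Param p)} {ρ : ℝ}

theorem mem_admissible_iff (hS : S ≤ Theta p) {θ : Param p} :
    θ ∈ admissible S ρ ↔ θ ∈ S ∧ (1 - C θ).PosDef ∧
      (algebraMap ℝ (Matrix (Torus p) (Torus p) ℝ) ρ - (1 - C θ)).PosDef := by
  constructor
  · rintro ⟨h1, h2, h3⟩
    exact ⟨h1, h2.2, (maxEigenvalue_lt_iff (posDef_isSymm h2.2) ρ).1 h3⟩
  · rintro ⟨h1, h2, h3⟩
    exact ⟨h1, ⟨hS h1, h2⟩, (maxEigenvalue_lt_iff (posDef_isSymm h2) ρ).2 h3⟩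

theorem convex_admissible (hS : S ≤ Theta p) : Convex ℝ (admissible S ρ) := by
  intro a ha b hb x y hx hy hxy
  rw [mem_admissible_iff hS] at ha hb ⊢
  obtain ⟨ha1, ha2, ha3⟩ := ha
  obtain ⟨hb1, hb2, hb3⟩ := hb
  have key : ∀ A B : Matrix (Torus p) (Torus p) ℝ, A.PosDef → B.PosDef →
      (x • A + y • B).PosDef := fun A B hA hB => by
    rcases hx.eq_or_lt with rfl | hx
    · obtain rfl : y = 1 := by linarith
      simpa using hB
    rcases hy.eq_or_lt with rfl | hy
    · obtain rfl : x = 1 := by linarith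
      simpa using hA
    exact (hA.smul hx).add (hB.smul hy)
  have e1 : 1 - C (x • a + y • b) = x • (1 - C a) + y • (1 - C b) := by
    rw [C_add, C_smul, C_smul]
    nth_rw 1 [← one_smul ℝ (1 : Matrix (Torus p) (Torus p) ℝ), ← hxy]
    module
  refine ⟨S.add_mem (S.smul_mem _ ha1) (S.smul_mem _ hb1), ?_, ?_⟩
  · rw [e1]
    exact key _ _ ha2 hb2
  · rw [e1]
    convert key _ _ ha3 hb3 using 1
    nth_rw 1 [← one_mul ρ, ← hxy]
    simp only [Algebra.algebraMap_eq_smul_one]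
    module

theorem frobSq_C (a : Param p) : frobSq (C a) = (p : ℝ) ^ 2 * (a ⬝ᵥ a) := by
  have h : ∀ j : Torus p, ∑ w, C a j w ^ 2 = a ⬝ᵥ a := fun j => by
    refine Fintype.sum_equiv (Equiv.subRight j) _ _ fun v => ?_
    simp [C, sq]
  simp only [frobSq, h, Finset.sum_const, Finset.card_univ, nsmul_eq_mul, card_torus]

/-- The admissible parameters form a relatively open subset of the linear model. -/
theorem exists_ball_subset_admissible (hS : S ≤ Theta p) {t : Param p}
    (ht : t ∈ admissible S ρ) :
    ∃ r > 0, ∀ δ ∈ S, δ ⬝ᵥ δ ≤ r → t + δ ∈ admissible S ρ := by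
  rw [mem_admissible_iff hS] at ht
  obtain ⟨h1, h2, h3⟩ := ht
  obtain ⟨c, hc, hcl⟩ := exists_lower_bound_of_posDef h2
  obtain ⟨c', hc', hcl'⟩ := exists_lower_bound_of_posDef h3
  have hp : (0 : ℝ) < (p : ℝ) ^ 2 := by
    have : (0 : ℝ) < p := Nat.cast_pos.2 (NeZero.pos p)
    positivity
  set b := min c c' / 2 with hb
  have hb0 : 0 < b := by positivity
  have hbc : b < c := by have := min_le_left c c'; linarith
  have hbc' : b < c' := by have := min_le_right c c'; linarith
  refine ⟨b ^ 2 / p ^ 2, by positivity, fun δ hδ hr => ?_⟩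
  have hq : ∀ x : Torus p → ℝ, |x ⬝ᵥ C δ *ᵥ x| ≤ b * (x ⬝ᵥ x) := fun x => by
    refine (quad_abs_le (C δ) x).trans ?_
    refine mul_le_mul_of_nonneg_right ?_ (dotProduct_self_nonneg' x)
    rw [Real.sqrt_le_left hb0.le, frobSq_C, mul_comm]
    exact (le_div_iff₀ hp).1 hr
  have hx0 : ∀ x : Torus p → ℝ, x ≠ 0 → 0 < x ⬝ᵥ x := fun x hx =>
    (dotProduct_self_nonneg' x).lt_of_ne fun h => hx (dotProduct_self_eq_zero.1 h.symm)
  have hsym : (C δ).IsSymm := C_isSymm (hS hδ).2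
  rw [mem_admissible_iff hS]
  refine ⟨S.add_mem h1 hδ, ?_, ?_⟩
  · have e : 1 - C (t + δ) = (1 - C t) - C δ := by rw [C_add]; abel
    rw [e]
    refine posDef_of_quad_pos ((posDef_isSymm h2).sub hsym) fun x hx => ?_
    rw [sub_mulVec, dotProduct_sub]
    have i1 := (abs_le.1 (hq x)).2
    have i2 := hcl x
    nlinarith [hx0 x hx]
  · have e : algebraMap ℝ (Matrix (Torus p) (Torus p) ℝ) ρ - (1 - C (t + δ)) =
        (algebraMap ℝ (Matrix (Torus p) (Torus p) ℝ) ρ - (1 - C t)) + C δ := by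
      rw [C_add]; abel
    rw [e]
    refine posDef_of_quad_pos ((posDef_isSymm h3).add hsym) fun x hx => ?_
    rw [add_mulVec, dotProduct_add]
    have i1 := (abs_le.1 (hq x)).1
    have i2 := hcl' x
    nlinarith [hx0 x hx]

theorem closure_admissible_subset : closure (admissible S ρ) ⊆ S :=
  closure_minimal (fun _ h => h.1) S.closed_of_finiteDimensional

theorem abs_le_one_of_mem_closure {y : Param p} (hy : y ∈ closure (admissible S ρ))
    (v : Torus p) : |y v| ≤ 1 := by
  have hc : IsClosed {y : Param p | |y v| ≤ 1} :=
    isClosed_le (by fun_prop) continuous_const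
  exact closure_minimal (fun θ h => abs_le_one_of_mem_thetaPlus h.2.1 v) hc hy

theorem isCompact_closure_admissible : IsCompact (closure (admissible S ρ)) :=
  isCompact_closure_of_subset_thetaPlus fun _ h => h.2.1

theorem nonempty_closure_admissible (hρ : 1 < ρ) : (closure (admissible S ρ)).Nonempty :=
  ⟨0, subset_closure ⟨zero_mem _, zero_mem_thetaPlus, by rwa [maxEigenvalue_zero]⟩⟩

end Admissible

/-! ### Minimizers of a perturbed quadratic criterion -/

section Perturbation

variable {ι : Type*} [Fintype ι]

/-- Two vectors that are relatively close in the norm of a positive definite form have nearly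
the same norm. The parameter `κ` is the weight of the inequality `2xy ≤ κ⁻¹ x² + κ y²`. -/
theorem abs_quad_sub_quad_le {A : Matrix ι ι ℝ} (hA : A.PosDef) {d g : ι → ℝ} {κ η : ℝ}
    (hκ0 : 0 < κ) (hη0 : 0 ≤ η) (hη : η ≤ 1 / 4) (hηκ : (1 + κ⁻¹) * (6 * η) ≤ κ)
    (h : (d - g) ⬝ᵥ A *ᵥ (d - g) ≤ η * (d ⬝ᵥ A *ᵥ d + g ⬝ᵥ A *ᵥ g)) :
    |d ⬝ᵥ A *ᵥ d - g ⬝ᵥ A *ᵥ g| ≤ 2 * κ * (g ⬝ᵥ A *ᵥ g) := by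
  have hsA := posDef_isSymm hA
  set N : (ι → ℝ) → ℝ := fun x => x ⬝ᵥ A *ᵥ x with hN
  have hN0 : ∀ x, 0 ≤ N x := posDef_quad_nonneg hA
  have hNdg' : N (d - g) ≤ η * (N d + N g) := h
  change |N d - N g| ≤ 2 * κ * N g
  have hNd2 : N d ≤ 2 * N (d - g) + 2 * N g := by
    have h : N (d - g - g) = N (d - g) - 2 * (g ⬝ᵥ A *ᵥ (d - g)) + N g := by
      simp only [hN]
      rw [quad_sub hsA]
    have h' : N d = N (d - g) + 2 * (g ⬝ᵥ A *ᵥ (d - g)) + N g := by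
      simp only [hN]
      rw [← quad_add hsA, sub_add_cancel]
    linarith [hN0 (d - g - g)]
  have hNd5 : N d ≤ 5 * N g := by nlinarith [hN0 d, hN0 g]
  have hNdg6 : N (d - g) ≤ 6 * η * N g := by nlinarith [hN0 d, hN0 g]
  have hdiff : N d - N g = N (d - g) + 2 * (g ⬝ᵥ A *ᵥ (d - g)) := by
    have h' : N d = N (d - g) + 2 * (g ⬝ᵥ A *ᵥ (d - g)) + N g := by
      simp only [hN]
      rw [← quad_add hsA, sub_add_cancel]
    linarith
  have hcross : |2 * (g ⬝ᵥ A *ᵥ (d - g))| ≤ κ⁻¹ * N (d - g) + κ * N g := by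
    have q1 : ∀ s : ℝ, 0 ≤ N (d - g) + 2 * (s * (g ⬝ᵥ A *ᵥ (d - g))) + s ^ 2 * N g := by
      intro s
      have := hN0 (d - g + s • g)
      have h : N (d - g + s • g) =
          N (d - g) + 2 * (s * (g ⬝ᵥ A *ᵥ (d - g))) + s ^ 2 * N g := by
        simp only [hN]
        rw [quad_add hsA]
        simp only [smul_dotProduct, mulVec_smul, dotProduct_smul, smul_eq_mul]
        ring
      linarith
    have p1 := mul_nonneg (inv_nonneg.2 hκ0.le) (q1 κ)
    have p2 := mul_nonneg (inv_nonneg.2 hκ0.le) (q1 (-κ))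
    have k1 : κ⁻¹ * κ = 1 := inv_mul_cancel₀ hκ0.ne'
    have f1 : κ⁻¹ * (N (d - g) + 2 * (κ * (g ⬝ᵥ A *ᵥ (d - g))) + κ ^ 2 * N g) =
        κ⁻¹ * N (d - g) + (κ⁻¹ * κ) * (2 * (g ⬝ᵥ A *ᵥ (d - g))) + (κ⁻¹ * κ) * κ * N g := by
      ring
    have f2 : κ⁻¹ * (N (d - g) + 2 * (-κ * (g ⬝ᵥ A *ᵥ (d - g))) + (-κ) ^ 2 * N g) =
        κ⁻¹ * N (d - g) - (κ⁻¹ * κ) * (2 * (g ⬝ᵥ A *ᵥ (d - g))) + (κ⁻¹ * κ) * κ * N g := by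
      ring
    rw [f1, k1] at p1
    rw [f2, k1] at p2
    rw [abs_le]
    constructor <;> linarith
  rw [hdiff]
  refine (abs_add_le _ _).trans ?_
  rw [abs_of_nonneg (hN0 (d - g))]
  have h6 : (1 + κ⁻¹) * N (d - g) ≤ κ * N g := by
    have i1 : (1 + κ⁻¹) * N (d - g) ≤ (1 + κ⁻¹) * (6 * η * N g) :=
      mul_le_mul_of_nonneg_left hNdg6 (by positivity)
    have i2 := mul_le_mul_of_nonneg_right hηκ (hN0 g)
    linarith
  linarith

/-- The minimizer `y` over `K` of a quadratic criterion with matrix `M` close to `A` is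
compared with the competitor `t + g`, where `g` is the minimizer of the linearized criterion.
The bound is uniform in `M`: a large perturbation is absorbed by the last term, since `K` is
bounded. -/
theorem exists_perturbation_bound {A : Matrix ι ι ℝ} (hA : A.PosDef) {S : Submodule ℝ (ι → ℝ)}
    {K : Set (ι → ℝ)} (hKS : K ⊆ S) (hK1 : ∀ y ∈ K, ∀ v, |y v| ≤ 1) {e t : ι → ℝ} (ht : t ∈ K)
    {r : ℝ} (hr : 0 < r) (hball : ∀ δ ∈ S, δ ⬝ᵥ δ ≤ r → t + δ ∈ K)
    (hopt : ∀ δ ∈ S, δ ⬝ᵥ A *ᵥ (e - t) = 0) :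
    ∃ a : ℝ, 0 ≤ a ∧ ∀ ε > 0, ∃ D : ℝ, 0 ≤ D ∧ ∀ (M : Matrix ι ι ℝ) (y g : ι → ℝ), M.IsSymm →
      y ∈ K → (∀ z ∈ K, (e - y) ⬝ᵥ M *ᵥ (e - y) ≤ (e - z) ⬝ᵥ M *ᵥ (e - z)) →
      g ∈ S → (∀ δ ∈ S, δ ⬝ᵥ A *ᵥ g = δ ⬝ᵥ (M - A) *ᵥ (e - t)) →
      g ⬝ᵥ A *ᵥ g ≤ a * frobSq (M - A) ∧
      |(y - t) ⬝ᵥ A *ᵥ (y - t) - g ⬝ᵥ A *ᵥ g| ≤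
        ε * frobSq (M - A) + D * frobSq (M - A) ^ 2 := by
  obtain ⟨c, hc, hcl⟩ := exists_lower_bound_of_posDef hA
  have hsA := posDef_isSymm hA
  set u := e - t with hu
  set N : (ι → ℝ) → ℝ := fun x => x ⬝ᵥ A *ᵥ x with hN
  have hN0 : ∀ x, 0 ≤ N x := posDef_quad_nonneg hA
  set a := (u ⬝ᵥ u) / c with ha
  have ha0 : 0 ≤ a := div_nonneg (dotProduct_self_nonneg' u) hc.le
  -- a bound of the quadratic form on `K - t`
  set B := √(frobSq A) * (4 * Fintype.card ι) with hB
  have hB0 : 0 ≤ B := by positivity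
  have hNB : ∀ y ∈ K, N (y - t) ≤ B := fun y hy => by
    refine (le_abs_self _).trans ((quad_abs_le A (y - t)).trans ?_)
    refine mul_le_mul_of_nonneg_left ?_ (Real.sqrt_nonneg _)
    have : ∀ v ∈ (Finset.univ : Finset ι), (y - t) v * (y - t) v ≤ 4 := fun v _ => by
      have h1 := abs_le.1 (hK1 y hy v)
      have h2 := abs_le.1 (hK1 t ht v)
      simp only [Pi.sub_apply]
      nlinarith
    calc (y - t) ⬝ᵥ (y - t) ≤ ∑ _v : ι, (4 : ℝ) := Finset.sum_le_sum this
      _ = 4 * Fintype.card ι := by simp [mul_comm]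
  have hgbound : ∀ (M : Matrix ι ι ℝ) (g : ι → ℝ), g ∈ S →
      (∀ δ ∈ S, δ ⬝ᵥ A *ᵥ g = δ ⬝ᵥ (M - A) *ᵥ u) → N g ≤ a * frobSq (M - A) := by
    intro M g hg hgE
    rcases (hN0 g).eq_or_lt with h0 | h0
    · rw [← h0]
      exact mul_nonneg ha0 (frobSq_nonneg _)
    have h1 := bilin_sq_le (M - A) g u
    rw [← hgE g hg] at h1
    change N g ^ 2 ≤ _ at h1
    have h2 : g ⬝ᵥ g ≤ N g / c := (le_div_iff₀ hc).2 (by rw [mul_comm]; exact hcl g)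
    have h3 : N g ^ 2 ≤ frobSq (M - A) * (N g / c) * (u ⬝ᵥ u) :=
      h1.trans (mul_le_mul_of_nonneg_right
        (mul_le_mul_of_nonneg_left h2 (frobSq_nonneg _)) (dotProduct_self_nonneg' u))
    have h4 : frobSq (M - A) * (N g / c) * (u ⬝ᵥ u) = (a * frobSq (M - A)) * N g := by
      rw [ha]; ring
    rw [h4, sq] at h3
    exact le_of_mul_le_mul_right h3 h0
  refine ⟨a, ha0, fun ε hε => ?_⟩
  set κ := ε / (2 * (a + 1)) with hκ
  have hκ0 : 0 < κ := by positivity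
  -- below the threshold `R₀` the perturbation argument applies
  obtain ⟨R₀, hR₀, hR₀1, hR₀2, hR₀3⟩ : ∃ R₀ : ℝ, 0 < R₀ ∧ R₀ / c ≤ 1 / 4 ∧
      a * R₀ ^ 2 / c ≤ r ∧ (1 + κ⁻¹) * (6 * (R₀ / c)) ≤ κ := by
    set s := min (min (c / 4) 1) (min (r * c / (a + 1)) (κ * c / (6 * (1 + κ⁻¹)))) with hs
    have hs0 : 0 < s := by positivity
    have s1 : s ≤ c / 4 := (min_le_left _ _).trans (min_le_left _ _)
    have s2 : s ≤ 1 := (min_le_left _ _).trans (min_le_right _ _)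
    have s3 : s ≤ r * c / (a + 1) := (min_le_right _ _).trans (min_le_left _ _)
    have s4 : s ≤ κ * c / (6 * (1 + κ⁻¹)) := (min_le_right _ _).trans (min_le_right _ _)
    refine ⟨s, hs0, ?_, ?_, ?_⟩
    · rw [div_le_iff₀ hc]; linarith
    · rw [div_le_iff₀ hc]
      rw [le_div_iff₀ (by positivity)] at s3
      nlinarith [mul_nonneg ha0 hs0.le]
    · rw [le_div_iff₀ (by positivity)] at s4
      have : (1 + κ⁻¹) * (6 * (s / c)) = s * (6 * (1 + κ⁻¹)) / c := by ring
      rw [this, div_le_iff₀ hc]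
      exact s4
  refine ⟨B / R₀ ^ 4 + a / R₀ ^ 2, by positivity, fun M y g hM hy hmin hg hgE => ?_⟩
  set F := frobSq (M - A) with hF
  have hF0 : 0 ≤ F := frobSq_nonneg _
  have hNg := hgbound M g hg hgE
  refine ⟨hNg, ?_⟩
  set R := √F with hR
  have hR2 : R ^ 2 = F := Real.sq_sqrt hF0
  have hR0 : 0 ≤ R := Real.sqrt_nonneg _
  change |N (y - t) - N g| ≤ _
  rcases le_or_gt R R₀ with hRR | hRR
  -- for a small perturbation, `t + g` is an admissible competitor
  · have hgr : g ⬝ᵥ g ≤ r := by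
      have h1 : g ⬝ᵥ g ≤ N g / c := (le_div_iff₀ hc).2 (by rw [mul_comm]; exact hcl g)
      refine h1.trans (le_trans ?_ hR₀2)
      rw [div_le_div_iff_of_pos_right hc]
      refine hNg.trans (mul_le_mul_of_nonneg_left ?_ ha0)
      rw [← hF, ← hR2]
      exact pow_le_pow_left₀ hR0 hRR 2
    have hcmp := hmin (t + g) (hball g hg hgr)
    set d := y - t with hd
    have hdS : d ∈ S := S.sub_mem (hKS hy) (hKS ht)
    have e1 : e - y = u - d := by rw [hu, hd]; abel
    have e2 : e - (t + g) = u - g := by rw [hu]; abel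
    rw [e1, e2, quad_sub hM u d, quad_sub hM u g] at hcmp
    have expand : ∀ x ∈ S, x ⬝ᵥ M *ᵥ u = x ⬝ᵥ A *ᵥ g := fun x hx => by
      rw [hgE x hx, sub_mulVec, dotProduct_sub, hopt x hx, sub_zero]
    have expand2 : ∀ x, x ⬝ᵥ M *ᵥ x = N x + x ⬝ᵥ (M - A) *ᵥ x := fun x => by
      rw [sub_mulVec, dotProduct_sub]; simp [hN]
    rw [expand d hdS, expand g hg, expand2 d, expand2 g] at hcmp
    have hη : ∀ x, |x ⬝ᵥ (M - A) *ᵥ x| ≤ (R / c) * N x := fun x => by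
      refine (quad_abs_le (M - A) x).trans ?_
      rw [div_mul_eq_mul_div, mul_div_assoc]
      refine mul_le_mul_of_nonneg_left ?_ hR0
      rw [le_div_iff₀ hc, mul_comm]
      exact hcl x
    have hηR : R / c ≤ R₀ / c := div_le_div_of_nonneg_right hRR hc.le
    set η := R₀ / c with hηdef
    have hη0 : 0 ≤ η := by positivity
    have hη' : ∀ x, |x ⬝ᵥ (M - A) *ᵥ x| ≤ η * N x := fun x =>
      (hη x).trans (mul_le_mul_of_nonneg_right hηR (hN0 x))
    have b1 := (abs_le.1 (hη' d)).1
    have b2 := (abs_le.1 (hη' g)).2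
    have hNdg : N (d - g) = N d - 2 * (d ⬝ᵥ A *ᵥ g) + N g := by
      simp only [hN]
      rw [quad_sub hsA, bilin_comm hsA g d]
    have hNdg' : N (d - g) ≤ η * (N d + N g) := by
      rw [hNdg]
      change _ - 2 * (d ⬝ᵥ A *ᵥ g) + (N d + _) ≤ _ - 2 * (N g) + (N g + _) at hcmp
      linarith
    have hfin : |N d - N g| ≤ 2 * κ * N g :=
      abs_quad_sub_quad_le hA hκ0 hη0 hR₀1 hR₀3 hNdg'
    refine hfin.trans ?_
    have h7 : 2 * κ * N g ≤ 2 * κ * (a * F) := mul_le_mul_of_nonneg_left hNg (by positivity)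
    have h8 : 2 * κ * (a * F) ≤ ε * F := by
      have : 2 * κ * a ≤ ε := by
        rw [hκ]
        have : 2 * (ε / (2 * (a + 1))) * a = ε * (a / (a + 1)) := by field_simp
        rw [this]
        have : a / (a + 1) ≤ 1 := by rw [div_le_one (by positivity)]; linarith
        exact mul_le_of_le_one_right hε.le this
      rw [← mul_assoc]
      exact mul_le_mul_of_nonneg_right this hF0
    have h9 : 0 ≤ (B / R₀ ^ 4 + a / R₀ ^ 2) * F ^ 2 := by positivity
    linarith
  -- for a large perturbation, the boundedness of `K` is enough
  · have hF1 : R₀ ^ 2 ≤ F := by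
      rw [← hR2]; exact pow_le_pow_left₀ hR₀.le hRR.le 2
    have h1 : |N (y - t) - N g| ≤ B + a * F := by
      have := hN0 (y - t)
      have := hN0 g
      have := hNB y hy
      rw [abs_le]
      have := mul_nonneg ha0 hF0
      constructor <;> linarith
    have h2 : B ≤ B / R₀ ^ 4 * F ^ 2 := by
      rw [div_mul_eq_mul_div, le_div_iff₀ (by positivity)]
      refine mul_le_mul_of_nonneg_left ?_ hB0
      calc R₀ ^ 4 = (R₀ ^ 2) ^ 2 := by ring
        _ ≤ F ^ 2 := pow_le_pow_left₀ (by positivity) hF1 2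
    have h3 : a * F ≤ a / R₀ ^ 2 * F ^ 2 := by
      rw [div_mul_eq_mul_div a, le_div_iff₀ (by positivity), sq F, ← mul_assoc]
      exact mul_le_mul_of_nonneg_left hF1 (by positivity)
    have h4 : 0 ≤ ε * F := by positivity
    rw [add_mul]
    linarith

end Perturbation

/-! ### Measurable dependence of a unique minimizer -/

/-- On a set of parameters where the minimizer over a compact set is unique, it depends
continuously on the parameter. -/
theorem continuousOn_of_unique_minimizer {Y E : Type*} [TopologicalSpace Y] [TopologicalSpace E]
    {K : Set E} (hK : IsCompact K) {F : Y → E → ℝ} (hF : Continuous fun q : Y × E => F q.1 q.2)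
    {a : Y → E} (haK : ∀ y, a y ∈ K) (hamin : ∀ y, IsMinOn (F y) K (a y)) {N : Set Y}
    (huniq : ∀ y ∈ N, ∀ z ∈ K, IsMinOn (F y) K z → z = a y) : ContinuousOn a N := by
  intro y₀ hy₀
  refine hK.tendsto_nhds_of_unique_mapClusterPt (Eventually.of_forall haK) fun z hz hcl => ?_
  refine huniq y₀ hy₀ z hz fun w hw => ?_
  by_contra hlt
  have hopen : IsOpen {q : Y × E | F q.1 w < F q.1 q.2} :=
    isOpen_lt (hF.comp (continuous_fst.prodMk continuous_const)) hF
  have hmem : {q : Y × E | F q.1 w < F q.1 q.2} ∈ 𝓝 (y₀, z) :=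
    hopen.mem_nhds (show F y₀ w < F y₀ z from not_le.1 hlt)
  obtain ⟨U, hU, W, hW, hUW⟩ := mem_nhds_prod_iff.1 hmem
  have h1 : ∃ᶠ y in 𝓝[N] y₀, a y ∈ W := hcl.frequently hW
  have h2 : ∀ᶠ y in 𝓝[N] y₀, y ∈ U := mem_nhdsWithin_of_mem_nhds hU
  obtain ⟨y, hyW, hyU⟩ := (h1.and_eventually h2).exists
  have h3 : F y w < F y (a y) := hUW (Set.mk_mem_prod hyU hyW)
  exact absurd (hamin y hw) (not_le.2 h3)

/-- A quadratic form that is positive on the differences of points of a convex set has at most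
one minimizer there. -/
theorem unique_minimizer_of_convex {ι : Type*} [Fintype ι] {M : Matrix ι ι ℝ} (hM : M.IsSymm)
    {K : Set (ι → ℝ)} (hK : Convex ℝ K) (e : ι → ℝ)
    (hpos : ∀ y ∈ K, ∀ z ∈ K, y ≠ z → 0 < (y - z) ⬝ᵥ M *ᵥ (y - z)) {y z : ι → ℝ}
    (hy : y ∈ K) (hz : z ∈ K) (hymin : IsMinOn (fun x => (e - x) ⬝ᵥ M *ᵥ (e - x)) K y)
    (hzmin : IsMinOn (fun x => (e - x) ⬝ᵥ M *ᵥ (e - x)) K z) : y = z := by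
  by_contra hne
  have hmid : (1 / 2 : ℝ) • y + (1 / 2 : ℝ) • z ∈ K := hK hy hz (by norm_num) (by norm_num)
    (by norm_num)
  have h1 := hymin hmid
  have h2 := hzmin hmid
  simp only [Set.mem_ofPred_eq] at h1 h2
  have h3 := hpos y hy z hz hne
  -- the parallelogram identity bounds the value at the midpoint
  have e1 : e - ((1 / 2 : ℝ) • y + (1 / 2 : ℝ) • z) =
      (1 / 2 : ℝ) • ((e - y) + (e - z)) := by module
  have e2 : y - z = (e - z) - (e - y) := by abel
  rw [e1] at h1 h2
  rw [e2, quad_sub hM] at h3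
  simp only [mulVec_smul, dotProduct_smul, smul_dotProduct, smul_eq_mul] at h1 h2
  rw [quad_add hM] at h1 h2
  have e3 := bilin_comm hM (e - y) (e - z)
  linarith

end GMRF

namespace GMRF

open Matrix
open scoped ENNReal

/-! ### Functions with finite moments -/

section Moments

variable {α : Type*} {mα : MeasurableSpace α} {μ : Measure α}

/-- The function `f` has finite moments of every order. -/
def HasMoments (f : α → ℝ) (μ : Measure α) : Prop := ∀ q : ℕ, MemLp f q μ

theorem HasMoments.mul {f g : α → ℝ} (hf : HasMoments f μ) (hg : HasMoments g μ) :
    HasMoments (fun x => f x * g x) μ := fun q => by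
  have : ENNReal.HolderTriple ((2 * q : ℕ) : ℝ≥0∞) ((2 * q : ℕ) : ℝ≥0∞) q := by
    constructor
    push_cast
    rw [ENNReal.mul_inv (by simp) (by simp), ← add_mul, ENNReal.inv_two_add_inv_two, one_mul]
  exact MemLp.mul' (hg (2 * q)) (hf (2 * q))

theorem HasMoments.add {f g : α → ℝ} (hf : HasMoments f μ) (hg : HasMoments g μ) :
    HasMoments (fun x => f x + g x) μ := fun q => (hf q).add (hg q)

theorem HasMoments.const_mul {f : α → ℝ} (hf : HasMoments f μ) (c : ℝ) :
    HasMoments (fun x => c * f x) μ := fun q => (hf q).const_mul c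

theorem hasMoments_const [IsFiniteMeasure μ] (c : ℝ) : HasMoments (fun _ : α => c) μ :=
  fun _ => memLp_const c

theorem HasMoments.sub_const [IsFiniteMeasure μ] {f : α → ℝ} (hf : HasMoments f μ) (c : ℝ) :
    HasMoments (fun x => f x - c) μ := fun q => (hf q).sub (memLp_const c)

theorem hasMoments_sum {κ : Type*} (s : Finset κ) {f : κ → α → ℝ}
    (hf : ∀ i ∈ s, HasMoments (f i) μ) : HasMoments (fun x => ∑ i ∈ s, f i x) μ :=
  fun q => memLp_finsetSum s fun i hi => hf i hi q

theorem HasMoments.pow [IsFiniteMeasure μ] {f : α → ℝ} (hf : HasMoments f μ) (k : ℕ) :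
    HasMoments (fun x => f x ^ k) μ := by
  induction k with
  | zero => simpa using hasMoments_const (μ := μ) 1
  | succ k ih => simpa only [pow_succ] using ih.mul hf

theorem HasMoments.integrable {f : α → ℝ} (hf : HasMoments f μ) : Integrable f μ :=
  memLp_one_iff_integrable.1 (by simpa using hf 1)

theorem HasMoments.comp_hasLaw {Ω : Type*} {mΩ : MeasurableSpace Ω} {P : Measure Ω} {X : Ω → α}
    (hX : HasLaw X μ P) {f : α → ℝ} (hf : HasMoments f μ) : HasMoments (fun ω => f (X ω)) P :=
  fun q => by
    have h := hf q
    rw [← hX.map_eq] at h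
    exact (memLp_map_measure_iff h.1 hX.aemeasurable).1 h

end Moments

/-! ### Moments of Gaussian vectors -/

section Gaussian

theorem integral_pow_four_gaussianReal (v : NNReal) :
    ∫ x, x ^ 4 ∂gaussianReal 0 v = 3 * (v : ℝ) ^ 2 := by
  have h := iteratedDeriv_mgf_zero (X := fun x : ℝ => x) (μ := gaussianReal 0 v) (by simp) 4
  simp only [Pi.pow_apply] at h
  rw [← h, mgf_fun_id_gaussianReal]
  generalize (v : ℝ) = w
  -- the successive derivatives of the moment generating function are polynomial multiples of it
  have step : ∀ P P' Q : ℝ → ℝ, (∀ t, HasDerivAt P (P' t) t) →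
      (∀ t, P' t + w * t * P t = Q t) →
      deriv (fun t => P t * Real.exp (0 * t + w * t ^ 2 / 2)) =
        fun t => Q t * Real.exp (0 * t + w * t ^ 2 / 2) := by
    intro P P' Q hP hQ
    ext t
    have h1 : HasDerivAt (fun t : ℝ => 0 * t + w * t ^ 2 / 2) (w * t) t := by
      have := ((hasDerivAt_id t).const_mul 0).fun_add
        (((hasDerivAt_pow 2 t).const_mul w).div_const 2)
      refine this.congr_deriv ?_
      norm_num
      ring
    rw [((hP t).fun_mul h1.exp).deriv, ← hQ]
    ring
  have h0 : (fun t : ℝ => Real.exp (0 * t + w * t ^ 2 / 2)) =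
      fun t => (fun _ => (1 : ℝ)) t * Real.exp (0 * t + w * t ^ 2 / 2) := by simp
  have d1 : ∀ t : ℝ, HasDerivAt (fun t => w * t) w t := fun t => by
    simpa using (hasDerivAt_id t).const_mul w
  have d2 : ∀ t : ℝ, HasDerivAt (fun t => w + w ^ 2 * t ^ 2) (2 * w ^ 2 * t) t := fun t => by
    refine (((hasDerivAt_pow 2 t).const_mul (w ^ 2)).const_add w).congr_deriv ?_
    norm_num
    ring
  have d3 : ∀ t : ℝ, HasDerivAt (fun t => 3 * w ^ 2 * t + w ^ 3 * t ^ 3)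
      (3 * w ^ 2 + 3 * w ^ 3 * t ^ 2) t := fun t => by
    refine (((hasDerivAt_id t).const_mul (3 * w ^ 2)).fun_add
        ((hasDerivAt_pow 3 t).const_mul (w ^ 3))).congr_deriv ?_
    norm_num
    ring
  simp only [iteratedDeriv_succ, iteratedDeriv_zero]
  rw [h0, step _ (fun _ => 0) (fun t => w * t) (fun t => hasDerivAt_const t 1)
      (fun t => by ring),
    step _ _ (fun t => w + w ^ 2 * t ^ 2) d1 (fun t => by ring),
    step _ _ (fun t => 3 * w ^ 2 * t + w ^ 3 * t ^ 3) d2 (fun t => by ring),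
    step _ _ (fun t => 3 * w ^ 2 + 6 * w ^ 3 * t ^ 2 + w ^ 4 * t ^ 4) d3 (fun t => by ring)]
  simp

variable {ι : Type*} [Fintype ι] {S : Matrix ι ι ℝ}

theorem posSemidef_quad_nonneg (hS : S.PosSemidef) (a : ι → ℝ) : 0 ≤ a ⬝ᵥ S *ᵥ a := by
  simpa using hS.dotProduct_mulVec_nonneg a

variable [DecidableEq ι]

theorem hasMoments_dotProduct (a : ι → ℝ) :
    HasMoments (fun x : EuclideanSpace ℝ ι => a ⬝ᵥ x.ofLp) (multivariateGaussian 0 S) :=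
  fun q => by
    have h := IsGaussian.memLp_dual (multivariateGaussian 0 S)
      (innerSL ℝ (WithLp.toLp 2 a : EuclideanSpace ℝ ι)) q (by simp)
    refine h.congr_norm ?_ (Eventually.of_forall fun x => ?_)
    · exact Continuous.aestronglyMeasurable (by fun_prop)
    · simp [EuclideanSpace.inner_eq_star_dotProduct, dotProduct_comm]

/-- A linear functional of a centred Gaussian vector is a centred Gaussian variable. -/
theorem map_dotProduct_multivariateGaussian (hS : S.PosSemidef) (a : ι → ℝ) :
    (multivariateGaussian 0 S).map (fun x : EuclideanSpace ℝ ι => a ⬝ᵥ x.ofLp) =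
      gaussianReal 0 (a ⬝ᵥ S *ᵥ a).toNNReal := by
  have e : (fun x : EuclideanSpace ℝ ι => a ⬝ᵥ x.ofLp) =
      innerSL ℝ (WithLp.toLp 2 a : EuclideanSpace ℝ ι) := by
    ext x
    simp [EuclideanSpace.inner_eq_star_dotProduct, dotProduct_comm]
  have hv : Var[innerSL ℝ (WithLp.toLp 2 a : EuclideanSpace ℝ ι); multivariateGaussian 0 S] =
      a ⬝ᵥ S *ᵥ a := by
    have h := covarianceBilin_self (μ := multivariateGaussian 0 S) IsGaussian.memLp_two_id
      (WithLp.toLp 2 a : EuclideanSpace ℝ ι)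
    rw [covarianceBilin_multivariateGaussian hS] at h
    exact h.symm
  rw [e, IsGaussian.map_eq_gaussianReal, hv, ContinuousLinearMap.integral_comp_id_comm]
  · simp
  · exact IsGaussian.integrable_id

theorem integral_dotProduct_pow_two (hS : S.PosSemidef) (a : ι → ℝ) :
    ∫ x : EuclideanSpace ℝ ι, (a ⬝ᵥ x.ofLp) ^ 2 ∂multivariateGaussian 0 S = a ⬝ᵥ S *ᵥ a := by
  have hm : AEMeasurable (fun x : EuclideanSpace ℝ ι => a ⬝ᵥ x.ofLp)
      (multivariateGaussian 0 S) := (hasMoments_dotProduct a 1).1.aemeasurable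
  rw [← integral_map (φ := fun x : EuclideanSpace ℝ ι => a ⬝ᵥ x.ofLp) hm
    (f := fun y => y ^ 2) (by fun_prop),
    map_dotProduct_multivariateGaussian hS]
  have h := variance_fun_id_gaussianReal (μ := 0) (v := (a ⬝ᵥ S *ᵥ a).toNNReal)
  rw [variance_of_integral_eq_zero (by fun_prop) (by simp)] at h
  rw [h, Real.coe_toNNReal _ (posSemidef_quad_nonneg hS a)]

theorem integral_dotProduct_pow_four (hS : S.PosSemidef) (a : ι → ℝ) :
    ∫ x : EuclideanSpace ℝ ι, (a ⬝ᵥ x.ofLp) ^ 4 ∂multivariateGaussian 0 S =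
      3 * (a ⬝ᵥ S *ᵥ a) ^ 2 := by
  have hm : AEMeasurable (fun x : EuclideanSpace ℝ ι => a ⬝ᵥ x.ofLp)
      (multivariateGaussian 0 S) := (hasMoments_dotProduct a 1).1.aemeasurable
  rw [← integral_map (φ := fun x : EuclideanSpace ℝ ι => a ⬝ᵥ x.ofLp) hm
    (f := fun y => y ^ 4) (by fun_prop),
    map_dotProduct_multivariateGaussian hS, integral_pow_four_gaussianReal,
    Real.coe_toNNReal _ (posSemidef_quad_nonneg hS a)]

theorem integral_dotProduct_mul_dotProduct (hS : S.PosSemidef) (a b : ι → ℝ) :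
    ∫ x : EuclideanSpace ℝ ι, (a ⬝ᵥ x.ofLp) * (b ⬝ᵥ x.ofLp) ∂multivariateGaussian 0 S =
      a ⬝ᵥ S *ᵥ b := by
  have hsym : S.IsSymm := by
    have := hS.isHermitian
    rwa [Matrix.IsHermitian, conjTranspose_eq_transpose_of_trivial] at this
  have h1 := integral_dotProduct_pow_two hS (a + b)
  have h2 := integral_dotProduct_pow_two hS (a - b)
  rw [quad_add hsym] at h1
  rw [quad_sub hsym] at h2
  have e : ∀ x : EuclideanSpace ℝ ι, (a ⬝ᵥ x.ofLp) * (b ⬝ᵥ x.ofLp) =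
      (1 / 4) * (((a + b) ⬝ᵥ x.ofLp) ^ 2 - ((a - b) ⬝ᵥ x.ofLp) ^ 2) := fun x => by
    rw [add_dotProduct, sub_dotProduct]
    ring
  simp_rw [e]
  rw [integral_const_mul, integral_sub ((hasMoments_dotProduct _).pow 2).integrable
    ((hasMoments_dotProduct _).pow 2).integrable, h1, h2, bilin_comm hsym a b]
  ring

/-- Isserlis' formula for the fourth moments of a centred Gaussian vector, obtained by
polarization from the fourth moments of its linear functionals. -/
theorem integral_dotProduct_mul_four (hS : S.PosSemidef) (a b c d : ι → ℝ) :
    ∫ x : EuclideanSpace ℝ ι, ((a ⬝ᵥ x.ofLp) * (b ⬝ᵥ x.ofLp)) * ((c ⬝ᵥ x.ofLp) * (d ⬝ᵥ x.ofLp))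
      ∂multivariateGaussian 0 S =
      (a ⬝ᵥ S *ᵥ b) * (c ⬝ᵥ S *ᵥ d) + (a ⬝ᵥ S *ᵥ c) * (b ⬝ᵥ S *ᵥ d) +
        (a ⬝ᵥ S *ᵥ d) * (b ⬝ᵥ S *ᵥ c) := by
  have hsym : S.IsSymm := by
    have := hS.isHermitian
    rwa [Matrix.IsHermitian, conjTranspose_eq_transpose_of_trivial] at this
  set w : ℝ → ℝ → ℝ → ι → ℝ := fun s t u => a + s • b + t • c + u • d with hw
  have hlin : ∀ s t u (x : EuclideanSpace ℝ ι), w s t u ⬝ᵥ x.ofLp =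
      a ⬝ᵥ x.ofLp + s * (b ⬝ᵥ x.ofLp) + t * (c ⬝ᵥ x.ofLp) + u * (d ⬝ᵥ x.ofLp) :=
    fun s t u x => by simp only [hw, add_dotProduct, smul_dotProduct, smul_eq_mul]
  have hquad : ∀ s t u, w s t u ⬝ᵥ S *ᵥ w s t u =
      a ⬝ᵥ S *ᵥ a + s ^ 2 * (b ⬝ᵥ S *ᵥ b) + t ^ 2 * (c ⬝ᵥ S *ᵥ c) + u ^ 2 * (d ⬝ᵥ S *ᵥ d) +
      2 * (s * (a ⬝ᵥ S *ᵥ b) + t * (a ⬝ᵥ S *ᵥ c) + u * (a ⬝ᵥ S *ᵥ d) +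
        s * t * (b ⬝ᵥ S *ᵥ c) + s * u * (b ⬝ᵥ S *ᵥ d) + t * u * (c ⬝ᵥ S *ᵥ d)) :=
    fun s t u => by
      simp only [hw, mulVec_add, mulVec_smul, dotProduct_add, dotProduct_smul, add_dotProduct,
        smul_dotProduct, smul_eq_mul, bilin_comm hsym b a, bilin_comm hsym c a,
        bilin_comm hsym d a, bilin_comm hsym c b, bilin_comm hsym d b, bilin_comm hsym d c]
      ring
  have hi : ∀ s t u, Integrable (fun x : EuclideanSpace ℝ ι => (w s t u ⬝ᵥ x.ofLp) ^ 4)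
      (multivariateGaussian 0 S) := fun s t u => ((hasMoments_dotProduct _).pow 4).integrable
  have e : ∀ x : EuclideanSpace ℝ ι,
      ((a ⬝ᵥ x.ofLp) * (b ⬝ᵥ x.ofLp)) * ((c ⬝ᵥ x.ofLp) * (d ⬝ᵥ x.ofLp)) =
      (1 / 192) * ((w 1 1 1 ⬝ᵥ x.ofLp) ^ 4 - (w 1 1 (-1) ⬝ᵥ x.ofLp) ^ 4 -
        (w 1 (-1) 1 ⬝ᵥ x.ofLp) ^ 4 - (w (-1) 1 1 ⬝ᵥ x.ofLp) ^ 4 +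
        (w 1 (-1) (-1) ⬝ᵥ x.ofLp) ^ 4 + (w (-1) 1 (-1) ⬝ᵥ x.ofLp) ^ 4 +
        (w (-1) (-1) 1 ⬝ᵥ x.ofLp) ^ 4 - (w (-1) (-1) (-1) ⬝ᵥ x.ofLp) ^ 4) := fun x => by
    simp only [hlin]
    ring
  simp_rw [e]
  rw [integral_const_mul, integral_sub, integral_add, integral_add, integral_add, integral_sub,
    integral_sub, integral_sub]
  · simp only [integral_dotProduct_pow_four hS, hquad]
    ring
  all_goals fun_prop (disch := exact hi _ _ _)

end Gaussian

/-! ### Sums of independent identically distributed variables -/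

section Sums

variable {Ω E : Type*} {mΩ : MeasurableSpace Ω} {mE : MeasurableSpace E} {P : Measure Ω}
  {μ : Measure E} {X : ℕ → Ω → E}

theorem integral_comp_hasLaw {Y : Ω → E} (hY : HasLaw Y μ P) {f : E → ℝ} (hf : Measurable f) :
    ∫ ω, f (Y ω) ∂P = ∫ x, f x ∂μ :=
  hY.integral_comp hf.aestronglyMeasurable

theorem integral_sum_mul_sum (hX : ∀ i, HasLaw (X i) μ P) (hind : iIndepFun X P) {f g : E → ℝ}
    (hf : Measurable f) (hg : Measurable g) (hfm : HasMoments f μ) (hgm : HasMoments g μ)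
    (hf0 : ∫ x, f x ∂μ = 0) (n : ℕ) :
    ∫ ω, (∑ i ∈ Finset.range n, f (X i ω)) * (∑ i ∈ Finset.range n, g (X i ω)) ∂P =
      n * ∫ x, f x * g x ∂μ := by
  simp_rw [Finset.sum_mul_sum]
  have hint : ∀ i j, Integrable (fun ω => f (X i ω) * g (X j ω)) P := fun i j =>
    ((hfm.comp_hasLaw (hX i)).mul (hgm.comp_hasLaw (hX j))).integrable
  rw [integral_finsetSum _ fun i _ => integrable_finsetSum _ fun j _ => hint i j]
  have h : ∀ i ∈ Finset.range n, ∫ ω, ∑ j ∈ Finset.range n, f (X i ω) * g (X j ω) ∂P =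
      ∫ x, f x * g x ∂μ := fun i hi => by
    rw [integral_finsetSum _ fun j _ => hint i j, Finset.sum_eq_single i]
    · exact integral_comp_hasLaw (f := fun x => f x * g x) (hX i) (hf.mul hg)
    · intro j _ hji
      rw [(hind.indepFun hji.symm).integral_fun_comp_mul_comp (hX i).aemeasurable
        (hX j).aemeasurable hf.aestronglyMeasurable hg.aestronglyMeasurable,
        integral_comp_hasLaw (hX i) hf, hf0, zero_mul]
    · exact fun h => absurd hi h
  rw [Finset.sum_congr rfl h]
  simp

variable [IsProbabilityMeasure P]

theorem integral_sum_pow_four_le (hX : ∀ i, HasLaw (X i) μ P) (hind : iIndepFun X P)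
    {f : E → ℝ} (hf : Measurable f) (hfm : HasMoments f μ) (hf0 : ∫ x, f x ∂μ = 0) (n : ℕ) :
    ∫ ω, (∑ i ∈ Finset.range n, f (X i ω)) ^ 4 ∂P ≤ 3 * (n : ℝ) ^ 2 * ∫ x, f x ^ 4 ∂μ := by
  have : IsProbabilityMeasure μ := (hX 0).isProbabilityMeasure_iff.1 inferInstance
  set v := ∫ x, f x ^ 2 ∂μ with hv
  set m := ∫ x, f x ^ 4 ∂μ with hm
  have hm0 : 0 ≤ m := integral_nonneg fun x => by positivity
  -- the square of the second moment is at most the fourth moment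
  have hvm : v ^ 2 ≤ m := by
    have h := variance_nonneg (fun x => f x ^ 2) μ
    rw [variance_eq_sub ((hfm.pow 2) 2)] at h
    have e : ∫ x, ((fun x => f x ^ 2) ^ 2) x ∂μ = m := by
      rw [hm]
      congr 1
      ext x
      simp only [Pi.pow_apply]
      ring
    rw [e] at h
    linarith
  induction n with
  | zero => simp
  | succ n ih =>
    set T : Ω → ℝ := fun ω => ∑ i ∈ Finset.range n, f (X i ω) with hT
    set Z : Ω → ℝ := fun ω => f (X n ω) with hZ
    have hTm : HasMoments T P := hasMoments_sum _ fun i _ => hfm.comp_hasLaw (hX i)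
    have hZm : HasMoments Z P := hfm.comp_hasLaw (hX n)
    have hTZ : IndepFun T Z P := by
      have h := (hind.comp (fun _ => f) fun _ => hf).indepFun_finsetSum_of_notMem₀
        (fun i => hf.comp_aemeasurable (hX i).aemeasurable) (s := Finset.range n) (i := n)
        (by simp)
      have e : ∑ j ∈ Finset.range n, f ∘ X j = T := by ext ω; simp [hT]
      rwa [e] at h
    have hprod : ∀ k l : ℕ, ∫ ω, T ω ^ k * Z ω ^ l ∂P = (∫ ω, T ω ^ k ∂P) * ∫ ω, Z ω ^ l ∂P :=
      fun k l => hTZ.integral_fun_comp_mul_comp (f := fun x => x ^ k) (g := fun x => x ^ l)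
        (hTm 1).1.aemeasurable (hZm 1).1.aemeasurable (by fun_prop) (by fun_prop)
    have hZl : ∀ l : ℕ, ∫ ω, Z ω ^ l ∂P = ∫ x, f x ^ l ∂μ := fun l =>
      integral_comp_hasLaw (f := fun x => f x ^ l) (hX n) (hf.pow_const l)
    have hi : ∀ k l : ℕ, Integrable (fun ω => T ω ^ k * Z ω ^ l) P := fun k l =>
      ((hTm.pow k).mul (hZm.pow l)).integrable
    have hT0 : ∫ ω, T ω ∂P = 0 := by
      rw [hT, integral_finsetSum _ fun i _ => (hfm.comp_hasLaw (hX i)).integrable]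
      exact Finset.sum_eq_zero fun i _ => by rw [integral_comp_hasLaw (hX i) hf, hf0]
    have hT2 : ∫ ω, T ω ^ 2 ∂P = n * v := by
      have h := integral_sum_mul_sum hX hind hf hf hfm hfm hf0 n
      simpa only [← sq] using h
    have hZ1 : ∫ ω, Z ω ^ 1 ∂P = 0 := by rw [hZl]; simpa using hf0
    have e : ∀ ω, (∑ i ∈ Finset.range (n + 1), f (X i ω)) ^ 4 =
        T ω ^ 4 * Z ω ^ 0 + 4 * (T ω ^ 3 * Z ω ^ 1) + 6 * (T ω ^ 2 * Z ω ^ 2) +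
          4 * (T ω ^ 1 * Z ω ^ 3) + T ω ^ 0 * Z ω ^ 4 := fun ω => by
      rw [Finset.sum_range_succ]
      ring
    simp_rw [e]
    rw [integral_add (by fun_prop (disch := exact hi _ _)) (hi _ _),
      integral_add (by fun_prop (disch := exact hi _ _)) ((hi _ _).const_mul _),
      integral_add (by fun_prop (disch := exact hi _ _)) ((hi _ _).const_mul _),
      integral_add (hi _ _) ((hi _ _).const_mul _)]
    simp only [integral_const_mul, hprod, hZ1, hT2]
    simp only [pow_one, hT0, hZl, pow_zero, integral_const, probReal_univ, smul_eq_mul, ← hv,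
      ← hm]
    push_cast
    have h6 : 6 * ((n : ℝ) * v * v) ≤ 6 * (n : ℝ) * m := by
      have : (n : ℝ) * v ^ 2 ≤ n * m := mul_le_mul_of_nonneg_left hvm (Nat.cast_nonneg n)
      nlinarith
    change ∫ ω, T ω ^ 4 ∂P ≤ _ at ih
    nlinarith

end Sums

end GMRF

namespace GMRF

open Matrix

/-! ### The criterion as a quadratic form in the empirical covariances -/

section Gram

variable {p : ℕ}

/-- The coefficients of the linear form `x ↦ x 0`: the criterion at `θ'` is the empirical
quadratic form evaluated at `unitZero - θ'`. -/
def unitZero (p : ℕ) : Param p := Pi.single 0 1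

theorem C_unitZero_sub (θ : Param p) : C (unitZero p - θ) = 1 - C θ := by
  rw [C_sub, unitZero, C_single_zero]

variable [NeZero p]

/-- The empirical covariances of a field, averaged over the translations of the torus. -/
noncomputable def gram (x : Field p) : Matrix (Torus p) (Torus p) ℝ :=
  Matrix.of fun v w => (1 / (p : ℝ) ^ 2) * ∑ j : Torus p, x (j + v) * x (j + w)

/-- The mean of `gram` over a sample. -/
noncomputable def sampleGram {n : ℕ} (x : Fin n → Field p) : Matrix (Torus p) (Torus p) ℝ :=
  (1 / (n : ℝ)) • ∑ i, gram (x i)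

theorem gram_isSymm (x : Field p) : (gram x).IsSymm := by
  ext v w
  simp only [gram, transpose_apply, of_apply, mul_comm]

theorem sampleGram_isSymm {n : ℕ} (x : Fin n → Field p) : (sampleGram x).IsSymm := by
  simp only [IsSymm, sampleGram, transpose_smul, transpose_sum, (gram_isSymm _).eq]

theorem bilin_gram (x : Field p) (a b : Param p) :
    a ⬝ᵥ gram x *ᵥ b =
      (1 / (p : ℝ) ^ 2) * ∑ j, (C a *ᵥ x.ofLp) j * (C b *ᵥ x.ofLp) j := by
  have h : ∀ j, (C a *ᵥ x.ofLp) j * (C b *ᵥ x.ofLp) j =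
      ∑ v, ∑ w, a v * (x (j + v) * x (j + w) * b w) := fun j => by
    rw [C_mulVec, C_mulVec, Finset.sum_mul_sum]
    exact Finset.sum_congr rfl fun v _ => Finset.sum_congr rfl fun w _ => by ring
  simp only [h]
  rw [Finset.sum_comm, Finset.mul_sum]
  refine Finset.sum_congr rfl fun v _ => ?_
  rw [Finset.sum_comm, Finset.mul_sum, mulVec, dotProduct, Finset.mul_sum]
  refine Finset.sum_congr rfl fun w _ => ?_
  simp only [gram, of_apply, Finset.mul_sum, Finset.sum_mul]
  exact Finset.sum_congr rfl fun j _ => by ring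

theorem bilin_sampleGram {n : ℕ} (x : Fin n → Field p) (a b : Param p) :
    a ⬝ᵥ sampleGram x *ᵥ b = (1 / (n : ℝ)) * ∑ i, a ⬝ᵥ gram (x i) *ᵥ b := by
  rw [sampleGram, smul_mulVec, dotProduct_smul, smul_eq_mul, sum_mulVec, dotProduct_sum]

theorem clsCriterion_eq {n : ℕ} (x : Fin n → Field p) {θ' : Param p} (h0 : θ' 0 = 0) :
    clsCriterion x θ' = (unitZero p - θ') ⬝ᵥ sampleGram x *ᵥ (unitZero p - θ') := by
  have h : ∀ i j, x i j - ∑ l ∈ Finset.univ.erase (0 : Torus p), θ' l * x i (j + l) =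
      (C (unitZero p - θ') *ᵥ (x i).ofLp) j := fun i j => by
    rw [C_unitZero_sub, sub_mulVec, one_mulVec, Pi.sub_apply, C_mulVec,
      ← Finset.sum_erase_add _ _ (Finset.mem_univ (0 : Torus p)), h0, zero_mul, add_zero]
  rw [bilin_sampleGram, clsCriterion]
  simp only [h, bilin_gram, ← Finset.mul_sum, ← mul_assoc, sq]
  congr 1
  field_simp

theorem loss_eq (σ : ℝ) (θ : Param p) {θ₁ θ₂ : Param p} (h : θ₁ - θ₂ ∈ Theta p) :
    loss σ θ θ₁ θ₂ = (θ₁ - θ₂) ⬝ᵥ covMatrix σ θ *ᵥ (θ₁ - θ₂) := by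
  have hp : (p : ℝ) ≠ 0 := Nat.cast_ne_zero.2 (NeZero.ne p)
  rw [loss, ← C_sub, trace_C_mul_C _ h.2 (stationary_covMatrix σ θ)]
  field_simp

end Gram

/-! ### Moments of the empirical covariances -/

section GramMoments

variable {p : ℕ} [NeZero p] {σ : ℝ} {θ : Param p}

theorem hasMoments_apply (v : Torus p) : HasMoments (fun x : Field p => x v) (fieldLaw σ θ) := by
  have h := hasMoments_dotProduct (S := covMatrix σ θ) (Pi.single v 1)
  simpa [fieldLaw] using h

theorem hasMoments_gram (v w : Torus p) :
    HasMoments (fun x : Field p => gram x v w) (fieldLaw σ θ) :=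
  HasMoments.const_mul (hasMoments_sum _ fun _ _ =>
    (hasMoments_apply _).mul (hasMoments_apply _)) _

theorem continuous_gram_apply (v w : Torus p) : Continuous fun x : Field p => gram x v w := by
  simp only [gram, of_apply]
  fun_prop

theorem continuous_gram : Continuous (gram : Field p → _) :=
  continuous_pi fun v => continuous_pi fun w => continuous_gram_apply v w

instance : IsProbabilityMeasure (fieldLaw σ θ) := by
  unfold fieldLaw
  infer_instance

theorem integral_gram (hσ : 0 < σ) (hθ : θ ∈ ThetaPlus p) (v w : Torus p) :
    ∫ x, gram x v w ∂fieldLaw σ θ = covMatrix σ θ v w := by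
  have hp : (p : ℝ) ≠ 0 := Nat.cast_ne_zero.2 (NeZero.ne p)
  simp only [gram, of_apply]
  rw [integral_const_mul, integral_finsetSum _ fun j _ =>
    ((hasMoments_apply _).mul (hasMoments_apply _)).integrable]
  have h : ∀ j : Torus p, ∫ x : Field p, x (j + v) * x (j + w) ∂fieldLaw σ θ =
      covMatrix σ θ v w := fun j => by
    have := integral_dotProduct_mul_dotProduct (covMatrix_posDef hσ hθ).posSemidef
      (Pi.single (j + v) 1) (Pi.single (j + w) 1)
    simp only [single_one_dotProduct, mulVec_single_one, col_apply] at this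
    rw [← stationary_covMatrix σ θ j v w]
    exact this
  simp only [h, Finset.sum_const, Finset.card_univ, nsmul_eq_mul, card_torus]
  field_simp

theorem dotProduct_mulVec_rows (A B S : Matrix (Torus p) (Torus p) ℝ) (j k : Torus p) :
    A j ⬝ᵥ S *ᵥ B k = (A * S * Bᵀ) j k := by
  rw [mul_assoc, mul_apply']
  rfl

theorem sum_mul_eq_trace (A B : Matrix (Torus p) (Torus p) ℝ) :
    ∑ j, ∑ k, A j k * B j k = (A * Bᵀ).trace := by
  simp [trace, mul_apply]

theorem hasMoments_bilin_gram (a b : Param p) :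
    HasMoments (fun x : Field p => a ⬝ᵥ gram x *ᵥ b) (fieldLaw σ θ) := by
  simp only [dotProduct, mulVec, Finset.mul_sum]
  exact hasMoments_sum _ fun v _ => hasMoments_sum _ fun w _ =>
    HasMoments.const_mul (by simpa only [mul_comm] using (hasMoments_gram v w).const_mul _) _

theorem integral_bilin_gram (hσ : 0 < σ) (hθ : θ ∈ ThetaPlus p) (a b : Param p) :
    ∫ x, a ⬝ᵥ gram x *ᵥ b ∂fieldLaw σ θ = a ⬝ᵥ covMatrix σ θ *ᵥ b := by
  simp only [dotProduct, mulVec, Finset.mul_sum]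
  have hi : ∀ v w : Torus p, Integrable (fun x : Field p => a v * (gram x v w * b w))
      (fieldLaw σ θ) := fun v w => ((hasMoments_gram v w).integrable.mul_const _).const_mul _
  rw [integral_finsetSum _ fun v _ => integrable_finsetSum _ fun w _ => hi v w]
  refine Finset.sum_congr rfl fun v _ => ?_
  rw [integral_finsetSum _ fun w _ => hi v w]
  refine Finset.sum_congr rfl fun w _ => ?_
  rw [integral_const_mul, integral_mul_const, integral_gram hσ hθ]

theorem covMatrix_commute (σ : ℝ) (hθ : θ ∈ ThetaPlus p) (a : Param p) :
    Commute (covMatrix σ θ) (C a) := by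
  have h1 : Commute (1 - C θ) (C a) :=
    (Commute.one_left _).sub_left (C_mul_comm θ a)
  refine Commute.smul_left ?_ _
  have hu : IsUnit (1 - C θ) := hθ.2.isUnit
  obtain ⟨U, hU⟩ := hu
  rw [← hU, ← coe_units_inv]
  rw [← hU] at h1
  exact h1.units_inv_left

/-- The covariances of the linear statistics that drive the estimator. -/
theorem integral_bilin_gram_mul (hσ : 0 < σ) (hθ : θ ∈ ThetaPlus p) (a : Param p)
    {b u : Param p} (hb : ∀ v, b v = b (-v)) (hu : ∀ v, u v = u (-v)) :
    ∫ x, (a ⬝ᵥ gram x *ᵥ u - a ⬝ᵥ covMatrix σ θ *ᵥ u) *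
        (b ⬝ᵥ gram x *ᵥ u - b ⬝ᵥ covMatrix σ θ *ᵥ u) ∂fieldLaw σ θ =
      2 * σ ^ 4 / (p : ℝ) ^ 4 * (C a * C u ^ 2 * ((1 - C θ)⁻¹) ^ 2 * C b).trace := by
  set S := covMatrix σ θ with hS
  have hpd := covMatrix_posDef hσ hθ
  have hps := hpd.posSemidef
  have hi1 := hasMoments_bilin_gram (σ := σ) (θ := θ) a u
  have hi2 := hasMoments_bilin_gram (σ := σ) (θ := θ) b u
  have hcov := covariance_eq_sub (hi1 2) (hi2 2)
  rw [covariance, integral_bilin_gram hσ hθ, integral_bilin_gram hσ hθ] at hcov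
  simp only [Pi.mul_apply] at hcov
  rw [hcov]
  -- the product of the two quadratic statistics
  have e2 : ∀ x : Field p, (a ⬝ᵥ gram x *ᵥ u) * (b ⬝ᵥ gram x *ᵥ u) =
      (1 / (p : ℝ) ^ 4) * ∑ j, ∑ k, ((C a j ⬝ᵥ x.ofLp) * (C u j ⬝ᵥ x.ofLp)) *
        ((C b k ⬝ᵥ x.ofLp) * (C u k ⬝ᵥ x.ofLp)) := fun x => by
    rw [bilin_gram, bilin_gram, ← Finset.sum_mul_sum]
    simp only [mulVec]
    ring
  simp_rw [e2]
  have hmd : ∀ c : Torus p → ℝ, HasMoments (fun x : Field p => c ⬝ᵥ x.ofLp) (fieldLaw σ θ) :=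
    fun c => hasMoments_dotProduct c
  have hi : ∀ j k, Integrable (fun x : Field p => ((C a j ⬝ᵥ x.ofLp) * (C u j ⬝ᵥ x.ofLp)) *
        ((C b k ⬝ᵥ x.ofLp) * (C u k ⬝ᵥ x.ofLp))) (fieldLaw σ θ) := fun j k =>
    (((hmd _).mul (hmd _)).mul ((hmd _).mul (hmd _))).integrable
  have hI : ∀ j k, ∫ x : Field p, ((C a j ⬝ᵥ x.ofLp) * (C u j ⬝ᵥ x.ofLp)) *
        ((C b k ⬝ᵥ x.ofLp) * (C u k ⬝ᵥ x.ofLp)) ∂fieldLaw σ θ =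
      (C a j ⬝ᵥ S *ᵥ C u j) * (C b k ⬝ᵥ S *ᵥ C u k) +
        (C a * S * (C b)ᵀ) j k * (C u * S * (C u)ᵀ) j k +
        (C a * S * (C u)ᵀ) j k * (C u * S * (C b)ᵀ) j k := fun j k => by
    simp only [← dotProduct_mulVec_rows]
    exact integral_dotProduct_mul_four hps _ _ _ _
  have hdiag : ∀ c : Param p, ∑ j, C c j ⬝ᵥ S *ᵥ C u j = (p : ℝ) ^ 2 * (c ⬝ᵥ S *ᵥ u) := fun c => by
    rw [← trace_C_mul_C c hu (stationary_covMatrix σ θ)]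
    simp only [dotProduct_mulVec_rows, (C_isSymm hu).eq]
    rfl
  have hp : (p : ℝ) ≠ 0 := Nat.cast_ne_zero.2 (NeZero.ne p)
  rw [integral_const_mul, integral_finsetSum _ fun j _ => integrable_finsetSum _ fun k _ => hi j k]
  rw [Finset.sum_congr rfl fun j _ => (integral_finsetSum _ fun k _ => hi j k).trans
    (Finset.sum_congr rfl fun k _ => hI j k)]
  simp only [Finset.sum_add_distrib]
  rw [← Finset.sum_mul_sum, hdiag, hdiag, sum_mul_eq_trace, sum_mul_eq_trace]
  have hsS : S.IsSymm := posDef_isSymm hpd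
  simp only [transpose_mul, (C_isSymm hb).eq, (C_isSymm hu).eq, hsS.eq]
  -- all the matrices commute
  set K := (1 - C θ)⁻¹ with hK
  have hSK : S = σ ^ 2 • K := rfl
  have cK : ∀ c : Param p, K * C c = C c * K := fun c => by
    have h := (covMatrix_commute 1 hθ c).eq
    simpa [covMatrix] using h
  have hl : ∀ c c' c'' : Param p, C a * S * C c * (C c' * (S * C c'')) =
      σ ^ 4 • (C a * (C c * (C c' * C c'')) * K ^ 2) := fun c c' c'' => by
    simp only [hSK, smul_mul_assoc, mul_smul_comm, smul_smul]
    congr 1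
    · ring
    · simp only [mul_assoc, sq]
      rw [← mul_assoc K (C c), cK, mul_assoc, ← mul_assoc K (C c'), cK, mul_assoc, cK c'',
        ← mul_assoc K (C c''), cK, mul_assoc]
  have t0 : C a * C u ^ 2 * K ^ 2 * C b = C a * (C b * (C u * C u)) * K ^ 2 := by
    simp only [mul_assoc, sq]
    rw [cK b, ← mul_assoc K (C b), cK, mul_assoc, ← mul_assoc (C u) (C b), C_mul_comm u b,
      mul_assoc, ← mul_assoc (C u) (C b), C_mul_comm u b, mul_assoc]
  have t1 : C a * S * C b * (C u * (S * C u)) = σ ^ 4 • (C a * C u ^ 2 * K ^ 2 * C b) := by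
    rw [hl, t0]
  have t2 : C a * S * C u * (C b * (S * C u)) = σ ^ 4 • (C a * C u ^ 2 * K ^ 2 * C b) := by
    rw [hl, t0, ← mul_assoc (C u) (C b), C_mul_comm u b, mul_assoc (C b)]
  rw [t1, t2, trace_smul, smul_eq_mul, ← hS]
  field_simp
  ring

theorem V_eq (hσ : 0 < σ) (hθ : θ ∈ ThetaPlus p) {d : ℕ} (Ψ : Fin d → Param p) (k l : Fin d) :
    V σ θ Ψ k l = Ψ k ⬝ᵥ covMatrix σ θ *ᵥ Ψ l := by
  have hm : ∀ c : Param p, HasMoments (fun x : Field p => c ⬝ᵥ x.ofLp) (fieldLaw σ θ) :=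
    fun c => hasMoments_dotProduct c
  have h := covariance_eq_sub (hm (Ψ k) 2) (hm (Ψ l) 2)
  have h0 : ∀ c : Param p, ∫ x : Field p, c ⬝ᵥ x.ofLp ∂fieldLaw σ θ = 0 := fun c => by
    have hmap := map_dotProduct_multivariateGaussian (covMatrix_posDef hσ hθ).posSemidef c
    have h1 : ∫ y, y ∂((fieldLaw σ θ).map fun x : Field p => c ⬝ᵥ x.ofLp) = 0 := by
      rw [fieldLaw, hmap]
      simp
    rwa [integral_map (hm c 1).1.aemeasurable (by fun_prop)] at h1
  rw [h0, zero_mul, sub_zero] at h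
  refine h.trans ?_
  exact integral_dotProduct_mul_dotProduct (covMatrix_posDef hσ hθ).posSemidef _ _

end GramMoments

end GMRF

namespace GMRF

open Matrix

/-! ### Almost sure uniqueness of the estimator -/

section Uniqueness

variable {p : ℕ} [NeZero p] {σ : ℝ} {θ : Param p}

/-- The fields all of whose Fourier coefficients have a nonzero real part. -/
def nondegenerateFields (p : ℕ) [NeZero p] : Set (Field p) :=
  {x | ∀ ψ : AddChar (Torus p) ℂ, (fun j => (ψ j).re) ⬝ᵥ x.ofLp ≠ 0}

theorem isOpen_nondegenerateFields : IsOpen (nondegenerateFields p) := by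
  have e : nondegenerateFields p =
      ⋂ ψ : AddChar (Torus p) ℂ, {x | (fun j => (ψ j).re) ⬝ᵥ x.ofLp ≠ 0} := by
    ext x
    simp [nondegenerateFields]
  rw [e]
  exact isOpen_iInter_of_finite fun ψ => isOpen_ne_fun (by fun_prop) continuous_const

theorem ae_mem_nondegenerateFields (hσ : 0 < σ) (hθ : θ ∈ ThetaPlus p) :
    ∀ᵐ x ∂fieldLaw σ θ, x ∈ nondegenerateFields p := by
  refine ae_all_iff.2 fun ψ => ?_
  set c : Param p := fun j => (ψ j).re with hc
  have hc0 : c ≠ 0 := fun h => by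
    have := congrFun h 0
    simp [hc] at this
  have hpd := covMatrix_posDef hσ hθ
  have hv : (c ⬝ᵥ covMatrix σ θ *ᵥ c).toNNReal ≠ 0 := by
    simpa using posDef_quad_pos hpd hc0
  have hmap := map_dotProduct_multivariateGaussian hpd.posSemidef c
  have : NullSingletonClass (gaussianReal 0 (c ⬝ᵥ covMatrix σ θ *ᵥ c).toNNReal) :=
    nullSingletonClass_gaussianReal hv
  have h0 : gaussianReal 0 (c ⬝ᵥ covMatrix σ θ *ᵥ c).toNNReal {0} = 0 := measure_singleton 0
  rw [← hmap, Measure.map_apply (by fun_prop) (measurableSet_singleton 0)] at h0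
  rw [ae_iff]
  have e : {x : Field p | ¬ c ⬝ᵥ x.ofLp ≠ 0} = (fun x : Field p => c ⬝ᵥ x.ofLp) ⁻¹' {0} := by
    ext x
    simp
  rw [e]
  exact h0

/-- Convolution by a field whose Fourier coefficients do not vanish is injective. -/
theorem eq_zero_of_C_mulVec_eq_zero {x : Field p} (hx : x ∈ nondegenerateFields p) {a : Param p}
    (ha : C a *ᵥ x.ofLp = 0) : a = 0 := by
  have hψ : ∀ ψ : AddChar (Torus p) ℂ, ∑ l, (a l : ℂ) * ψ (-l) = 0 := fun ψ => by
    have h1 : ∑ j, ψ j * ((C a *ᵥ x.ofLp) j : ℂ) = 0 := by simp [ha]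
    have h2 : ∑ j, ψ j * ((C a *ᵥ x.ofLp) j : ℂ) =
        (∑ l, (a l : ℂ) * ψ (-l)) * ∑ j, ψ j * (x j : ℂ) := by
      simp only [C_mulVec, Complex.ofReal_sum, Complex.ofReal_mul, Finset.mul_sum,
        Finset.sum_mul]
      rw [Finset.sum_comm, Finset.sum_comm (s := Finset.univ (α := Torus p))
        (f := fun i k => (a k : ℂ) * ψ (-k) * (ψ i * (x i : ℂ)))]
      refine Finset.sum_congr rfl fun l _ => ?_
      refine Fintype.sum_equiv (Equiv.addRight l) _ _ fun j => ?_
      simp only [Equiv.coe_addRight]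
      have : ψ j = ψ (-l) * ψ (j + l) := by
        rw [← AddChar.map_add_eq_mul]; congr 1; abel
      rw [this]
      ring
    rw [h1] at h2
    refine (mul_eq_zero.1 h2.symm).resolve_right fun h3 => hx ψ ?_
    have h4 := congrArg Complex.re h3
    simpa [dotProduct] using h4
  -- the characters span the functions on the torus
  set T : (Torus p → ℂ) →ₗ[ℂ] ℂ :=
    ∑ l, (a l : ℂ) • LinearMap.proj (R := ℂ) (φ := fun _ : Torus p => ℂ) (-l) with hT
  have hT0 : T = 0 := by
    refine (AddChar.complexBasis (Torus p)).ext fun ψ => ?_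
    simp only [AddChar.complexBasis_apply, hT, LinearMap.sum_apply, LinearMap.smul_apply,
      LinearMap.proj_apply, smul_eq_mul, LinearMap.zero_apply]
    exact hψ ψ
  ext l
  have h := LinearMap.congr_fun hT0 (Pi.single (-l) 1)
  simp only [hT, LinearMap.sum_apply, LinearMap.smul_apply, LinearMap.proj_apply, smul_eq_mul,
    LinearMap.zero_apply, Pi.single_apply, neg_inj] at h
  simpa using h

theorem quad_sampleGram_pos {n : ℕ} {x : Fin n → Field p} {i : Fin n}
    (hx : x i ∈ nondegenerateFields p) {a : Param p} (ha : a ≠ 0) :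
    0 < a ⬝ᵥ sampleGram x *ᵥ a := by
  have hp : (0 : ℝ) < p := Nat.cast_pos.2 (NeZero.pos p)
  have hn : (0 : ℝ) < n := Nat.cast_pos.2 (Fin.pos i)
  have hnn : ∀ k, 0 ≤ a ⬝ᵥ gram (x k) *ᵥ a := fun k => by
    rw [bilin_gram]
    exact mul_nonneg (by positivity) (Finset.sum_nonneg fun _ _ => mul_self_nonneg _)
  have hpos : 0 < a ⬝ᵥ gram (x i) *ᵥ a := by
    refine (hnn i).lt_of_ne fun h => ha (eq_zero_of_C_mulVec_eq_zero hx ?_)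
    rw [bilin_gram, eq_comm, mul_eq_zero] at h
    have h' := h.resolve_left (by positivity)
    exact dotProduct_self_eq_zero.1 h'
  rw [bilin_sampleGram]
  exact mul_pos (by positivity)
    (Finset.sum_pos' (fun k _ => hnn k) ⟨i, Finset.mem_univ i, hpos⟩)

variable {S : Submodule ℝ (Param p)} {ρ : ℝ}

/-- The conditional least squares estimator of the linear model `S`. -/
noncomputable def estimator (S : Submodule ℝ (Param p)) (ρ : ℝ) {n : ℕ} (x : Fin n → Field p) :
    Param p :=
  argminOn (clsCriterion x) (closure (admissible S ρ))

theorem estimator_spec (hρ : 1 < ρ) {n : ℕ} (x : Fin n → Field p) :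
    estimator S ρ x ∈ closure (admissible S ρ) ∧
      IsMinOn (clsCriterion x) (closure (admissible S ρ)) (estimator S ρ x) :=
  argminOn_spec (clsCriterion_continuous x) isCompact_closure_admissible
    (nonempty_closure_admissible hρ)

theorem continuousOn_estimator (hS : S ≤ Theta p) (hρ : 1 < ρ) {n : ℕ} (i : Fin n) :
    ContinuousOn (fun x : Fin n → Field p => estimator S ρ x)
      {x | x i ∈ nondegenerateFields p} := by
  refine continuousOn_of_unique_minimizer
    (isCompact_closure_admissible (S := S) (ρ := ρ))
    (F := fun x θ' => clsCriterion x θ') ?_ (fun x => (estimator_spec hρ x).1)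
    (fun x => (estimator_spec hρ x).2) fun x hx z hz hzmin => ?_
  · unfold clsCriterion
    fun_prop
  · have h0 : ∀ y ∈ closure (admissible S ρ), y 0 = 0 := fun y hy =>
      (hS (closure_admissible_subset hy)).1
    have hconv : ∀ y ∈ closure (admissible S ρ),
        IsMinOn (clsCriterion x) (closure (admissible S ρ)) y →
        IsMinOn (fun w => (unitZero p - w) ⬝ᵥ sampleGram x *ᵥ (unitZero p - w))
          (closure (admissible S ρ)) y := fun y hy hmin w hw => by
      have h := hmin hw
      simp only [Set.mem_ofPred_eq] at h ⊢
      rwa [clsCriterion_eq x (h0 y hy), clsCriterion_eq x (h0 w hw)] at h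
    have he := estimator_spec (S := S) hρ x
    exact unique_minimizer_of_convex (sampleGram_isSymm x) (convex_admissible hS).closure
      (unitZero p) (fun y _ w _ hne => quad_sampleGram_pos hx (sub_ne_zero.2 hne)) hz he.1
      (hconv z hz hzmin) (hconv _ he.1 he.2)

theorem aestronglyMeasurable_estimator_comp (hS : S ≤ Theta p) (hρ : 1 < ρ) (hσ : 0 < σ)
    (hθ : θ ∈ ThetaPlus p) {Ω : Type*} [MeasurableSpace Ω] {P : Measure Ω}
    {X : ℕ → Ω → Field p} (hX : ∀ i, HasLaw (X i) (fieldLaw σ θ) P) {n : ℕ} (hn : 1 ≤ n)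
    {h : Param p → ℝ} (hh : Continuous h) :
    AEStronglyMeasurable (fun ω => h (estimator S ρ (fun i : Fin n => X i ω))) P := by
  set i₀ : Fin n := ⟨0, hn⟩
  set N : Set (Fin n → Field p) := {x | x i₀ ∈ nondegenerateFields p} with hN
  have hNo : IsOpen N := isOpen_nondegenerateFields.preimage (continuous_apply i₀)
  have hXm : AEMeasurable (fun ω => fun i : Fin n => X i ω) P :=
    aemeasurable_pi_lambda _ fun i => (hX i).aemeasurable
  have hae : ∀ᵐ x ∂P.map (fun ω => fun i : Fin n => X i ω), x ∈ N := by
    refine (ae_map_iff (p := fun x => x ∈ N) hXm hNo.measurableSet).2 ?_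
    have h1 := ae_mem_nondegenerateFields hσ hθ
    rw [← (hX 0).map_eq] at h1
    exact (ae_map_iff (p := fun x => x ∈ nondegenerateFields p) (hX 0).aemeasurable
      isOpen_nondegenerateFields.measurableSet).1 h1
  have h1 : AEStronglyMeasurable (fun x : Fin n → Field p => h (estimator S ρ x))
      (P.map fun ω => fun i : Fin n => X i ω) := by
    rw [← Measure.restrict_eq_self_of_ae_mem hae]
    exact (hh.comp_continuousOn (continuousOn_estimator hS hρ i₀)).aestronglyMeasurable
      hNo.measurableSet
  exact h1.comp_aemeasurable hXm

end Uniqueness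

end GMRF

namespace GMRF

open Matrix

/-! ### Fluctuations of the empirical covariances -/

section Fluctuations

variable {p : ℕ} [NeZero p] {σ : ℝ} {θ : Param p} {Ω : Type*}
  {X : ℕ → Ω → Field p}

/-- The deviation of the empirical covariances of the first `n` fields from their mean. -/
noncomputable def deviation (σ : ℝ) (θ : Param p) (X : ℕ → Ω → Field p) (n : ℕ) (ω : Ω) :
    Matrix (Torus p) (Torus p) ℝ :=
  sampleGram (fun i : Fin n => X i ω) - covMatrix σ θ

theorem bilin_deviation {n : ℕ} (hn : 1 ≤ n) (ω : Ω) (a b : Param p) :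
    a ⬝ᵥ deviation σ θ X n ω *ᵥ b = (1 / (n : ℝ)) * ∑ i ∈ Finset.range n,
      (a ⬝ᵥ gram (X i ω) *ᵥ b - a ⬝ᵥ covMatrix σ θ *ᵥ b) := by
  have hn0 : (n : ℝ) ≠ 0 := by positivity
  rw [deviation, sub_mulVec, dotProduct_sub, bilin_sampleGram, Finset.sum_sub_distrib,
    Finset.sum_range]
  simp only [Finset.sum_const, Finset.card_range, nsmul_eq_mul]
  field_simp

theorem deviation_apply {n : ℕ} (hn : 1 ≤ n) (ω : Ω) (v w : Torus p) :
    deviation σ θ X n ω v w = (1 / (n : ℝ)) * ∑ i ∈ Finset.range n,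
      (gram (X i ω) v w - covMatrix σ θ v w) := by
  have h := bilin_deviation (σ := σ) (θ := θ) (X := X) hn ω (Pi.single v 1) (Pi.single w 1)
  simpa only [single_one_dotProduct, mulVec_single_one, col_apply] using h

variable [MeasurableSpace Ω] {P : Measure Ω}

theorem hasMoments_deviation (hX : ∀ i, HasLaw (X i) (fieldLaw σ θ) P) {n : ℕ} (hn : 1 ≤ n)
    (v w : Torus p) : HasMoments (fun ω => deviation σ θ X n ω v w) P := by
  simp only [deviation_apply hn]
  exact HasMoments.const_mul (hasMoments_sum _ fun i _ =>
    ((hasMoments_gram v w).sub_const (covMatrix σ θ v w)).comp_hasLaw (hX i)) _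

theorem hasMoments_frobSq_deviation (hX : ∀ i, HasLaw (X i) (fieldLaw σ θ) P) {n : ℕ}
    (hn : 1 ≤ n) [IsProbabilityMeasure P] :
    HasMoments (fun ω => frobSq (deviation σ θ X n ω)) P :=
  hasMoments_sum _ fun v _ => hasMoments_sum _ fun w _ => (hasMoments_deviation hX hn v w).pow 2

theorem integral_gram_sub (hσ : 0 < σ) (hθ : θ ∈ ThetaPlus p) (v w : Torus p) :
    ∫ x, (gram x v w - covMatrix σ θ v w) ∂fieldLaw σ θ = 0 := by
  rw [integral_sub (hasMoments_gram v w).integrable (integrable_const _), integral_gram hσ hθ,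
    integral_const, probReal_univ, one_smul, sub_self]

/-- The covariances of the linear statistics `Ψ_k ⬝ᵥ deviation *ᵥ (unitZero - t)` are the entries
of `W`, up to a factor. -/
theorem integral_bilin_deviation_mul (hσ : 0 < σ) (hθ : θ ∈ ThetaPlus p)
    (hX : ∀ i, HasLaw (X i) (fieldLaw σ θ) P) (hind : iIndepFun X P) {t : Param p}
    (ht : t ∈ Theta p) {d : ℕ} {Ψ : Fin d → Param p} (hΨ : ∀ k, Ψ k ∈ Theta p) {n : ℕ}
    (hn : 1 ≤ n) (k l : Fin d) :
    ∫ ω, (Ψ k ⬝ᵥ deviation σ θ X n ω *ᵥ (unitZero p - t)) *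
        (Ψ l ⬝ᵥ deviation σ θ X n ω *ᵥ (unitZero p - t)) ∂P =
      1 / (n * (p : ℝ) ^ 2) * (2 * σ ^ 4 * W θ t Ψ k l) := by
  set u := unitZero p - t with hu
  have hus : ∀ v, u v = u (-v) := fun v => by
    simp only [hu, Pi.sub_apply, unitZero, Pi.single_apply, neg_eq_zero]
    rw [ht.2 v]
  have hm : ∀ a : Param p, HasMoments
      (fun x => a ⬝ᵥ gram x *ᵥ u - a ⬝ᵥ covMatrix σ θ *ᵥ u) (fieldLaw σ θ) := fun a =>
    (hasMoments_bilin_gram a u).sub_const _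
  have hc : ∀ a : Param p, Measurable
      fun x : Field p => a ⬝ᵥ gram x *ᵥ u - a ⬝ᵥ covMatrix σ θ *ᵥ u := fun a => by
    have := continuous_gram (p := p)
    exact Continuous.measurable (by fun_prop)
  have h0 : ∫ x, (Ψ k ⬝ᵥ gram x *ᵥ u - Ψ k ⬝ᵥ covMatrix σ θ *ᵥ u) ∂fieldLaw σ θ = 0 := by
    rw [integral_sub (hasMoments_bilin_gram _ _).integrable (integrable_const _),
      integral_bilin_gram hσ hθ, integral_const, probReal_univ, one_smul, sub_self]
  have h := integral_sum_mul_sum hX hind (hc (Ψ k)) (hc (Ψ l)) (hm _) (hm _) h0 n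
  rw [integral_bilin_gram_mul hσ hθ (Ψ k) (hΨ l).2 hus] at h
  have hn0 : (n : ℝ) ≠ 0 := by positivity
  have hp : (p : ℝ) ≠ 0 := Nat.cast_ne_zero.2 (NeZero.ne p)
  have e : ∀ ω, (Ψ k ⬝ᵥ deviation σ θ X n ω *ᵥ u) * (Ψ l ⬝ᵥ deviation σ θ X n ω *ᵥ u) =
      (1 / (n : ℝ) ^ 2) * ((∑ i ∈ Finset.range n,
        (Ψ k ⬝ᵥ gram (X i ω) *ᵥ u - Ψ k ⬝ᵥ covMatrix σ θ *ᵥ u)) * ∑ i ∈ Finset.range n,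
        (Ψ l ⬝ᵥ gram (X i ω) *ᵥ u - Ψ l ⬝ᵥ covMatrix σ θ *ᵥ u)) := fun ω => by
    rw [bilin_deviation hn, bilin_deviation hn]
    ring
  simp_rw [e]
  rw [integral_const_mul, h, W, of_apply, C_unitZero_sub]
  field_simp

variable [IsProbabilityMeasure P]

/-- The deviation of the empirical covariances is of order `n ^ (-1/2)` in mean square. -/
theorem exists_integral_frobSq_le (hσ : 0 < σ) (hθ : θ ∈ ThetaPlus p)
    (hX : ∀ i, HasLaw (X i) (fieldLaw σ θ) P) (hind : iIndepFun X P) :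
    ∃ A : ℝ, 0 ≤ A ∧ ∀ n : ℕ, 1 ≤ n → ∫ ω, frobSq (deviation σ θ X n ω) ∂P ≤ A / n := by
  refine ⟨∑ v, ∑ w, ∫ x, (gram x v w - covMatrix σ θ v w) * (gram x v w - covMatrix σ θ v w)
    ∂fieldLaw σ θ, Finset.sum_nonneg fun v _ => Finset.sum_nonneg fun w _ =>
      integral_nonneg fun x => mul_self_nonneg _, fun n hn => le_of_eq ?_⟩
  have hn0 : (n : ℝ) ≠ 0 := by positivity
  have hi : ∀ v w, Integrable (fun ω => deviation σ θ X n ω v w ^ 2) P := fun v w =>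
    ((hasMoments_deviation hX hn v w).pow 2).integrable
  simp only [frobSq]
  rw [integral_finsetSum _ fun v _ => integrable_finsetSum _ fun w _ => hi v w, Finset.sum_div]
  refine Finset.sum_congr rfl fun v _ => ?_
  rw [integral_finsetSum _ fun w _ => hi v w, Finset.sum_div]
  refine Finset.sum_congr rfl fun w _ => ?_
  have hm : HasMoments (fun x => gram x v w - covMatrix σ θ v w) (fieldLaw σ θ) :=
    (hasMoments_gram v w).sub_const _
  have hc : Measurable fun x : Field p => gram x v w - covMatrix σ θ v w :=
    (continuous_gram_apply v w).measurable.sub_const _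
  have h := integral_sum_mul_sum hX hind hc hc hm hm (integral_gram_sub hσ hθ v w) n
  simp only [deviation_apply hn, mul_pow]
  rw [integral_const_mul]
  simp only [sq (∑ i ∈ Finset.range n, _)]
  rw [h]
  field_simp

/-- The fourth moment of the deviation of the empirical covariances is of order `n ^ (-2)`. -/
theorem exists_integral_frobSq_sq_le (hσ : 0 < σ) (hθ : θ ∈ ThetaPlus p)
    (hX : ∀ i, HasLaw (X i) (fieldLaw σ θ) P) (hind : iIndepFun X P) :
    ∃ B : ℝ, 0 ≤ B ∧ ∀ n : ℕ, 1 ≤ n →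
      ∫ ω, frobSq (deviation σ θ X n ω) ^ 2 ∂P ≤ B / (n : ℝ) ^ 2 := by
  set N : ℝ := (Fintype.card (Torus p × Torus p) : ℝ)
  refine ⟨N * ∑ v, ∑ w, 3 * ∫ x, (gram x v w - covMatrix σ θ v w) ^ 4 ∂fieldLaw σ θ,
    mul_nonneg (Nat.cast_nonneg _) (Finset.sum_nonneg fun v _ => Finset.sum_nonneg fun w _ =>
      mul_nonneg (by norm_num) (integral_nonneg fun x => by positivity)), fun n hn => ?_⟩
  have hn0 : (n : ℝ) ≠ 0 := by positivity
  have hi : ∀ v w, Integrable (fun ω => deviation σ θ X n ω v w ^ 4) P := fun v w =>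
    ((hasMoments_deviation hX hn v w).pow 4).integrable
  have hcs : ∀ ω, frobSq (deviation σ θ X n ω) ^ 2 ≤
      N * ∑ v, ∑ w, deviation σ θ X n ω v w ^ 4 := fun ω => by
    have h := sq_sum_le_card_mul_sum_sq (s := (Finset.univ : Finset (Torus p × Torus p)))
      (f := fun q => deviation σ θ X n ω q.1 q.2 ^ 2)
    rw [Fintype.sum_prod_type (fun q : Torus p × Torus p => deviation σ θ X n ω q.1 q.2 ^ 2),
      Fintype.sum_prod_type
        (fun q : Torus p × Torus p => (deviation σ θ X n ω q.1 q.2 ^ 2) ^ 2)] at h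
    simp only [← pow_mul] at h
    exact h
  calc ∫ ω, frobSq (deviation σ θ X n ω) ^ 2 ∂P
      ≤ ∫ ω, N * ∑ v, ∑ w, deviation σ θ X n ω v w ^ 4 ∂P :=
        integral_mono ((hasMoments_frobSq_deviation hX hn).pow 2).integrable
          ((integrable_finsetSum _ fun v _ => integrable_finsetSum _ fun w _ =>
            hi v w).const_mul N) hcs
    _ = N * ∑ v, ∑ w, ∫ ω, deviation σ θ X n ω v w ^ 4 ∂P := by
        rw [integral_const_mul,
          integral_finsetSum _ fun v _ => integrable_finsetSum _ fun w _ => hi v w]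
        congr 1
        exact Finset.sum_congr rfl fun v _ => integral_finsetSum _ fun w _ => hi v w
    _ ≤ _ := by
        rw [mul_div_assoc]
        refine mul_le_mul_of_nonneg_left ?_ (Nat.cast_nonneg _)
        rw [Finset.sum_div]
        refine Finset.sum_le_sum fun v _ => ?_
        rw [Finset.sum_div]
        refine Finset.sum_le_sum fun w _ => ?_
        have hm : HasMoments (fun x => gram x v w - covMatrix σ θ v w) (fieldLaw σ θ) :=
          (hasMoments_gram v w).sub_const _
        have hc : Measurable fun x : Field p => gram x v w - covMatrix σ θ v w :=
          (continuous_gram_apply v w).measurable.sub_const _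
        have h := integral_sum_pow_four_le hX hind hc hm (integral_gram_sub hσ hθ v w) n
        simp only [deviation_apply hn, mul_pow]
        rw [integral_const_mul]
        refine (mul_le_mul_of_nonneg_left h (by positivity)).trans (le_of_eq ?_)
        field_simp

end Fluctuations

/-! ### The linearized estimator -/

section Linearized

variable {p : ℕ} [NeZero p] {σ : ℝ} {θ : Param p} {S : Submodule ℝ (Param p)} {d : ℕ}
  {Ψ : Fin d → Param p}

theorem V_posDef (hσ : 0 < σ) (hθ : θ ∈ ThetaPlus p) (hΨ : LinearIndependent ℝ Ψ) :
    (V σ θ Ψ).PosDef := by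
  have hpd := covMatrix_posDef hσ hθ
  refine posDef_of_quad_pos ?_ fun x hx => ?_
  · ext k l
    rw [transpose_apply, V_eq hσ hθ, V_eq hσ hθ, bilin_comm (posDef_isSymm hpd)]
  · have hne : ∑ k, x k • Ψ k ≠ 0 := fun h =>
      hx (funext (Fintype.linearIndependent_iff.1 hΨ x h))
    have h := posDef_quad_pos hpd hne
    simp only [mulVec_sum, dotProduct_sum, sum_dotProduct, mulVec_smul, smul_dotProduct,
      dotProduct_smul, smul_eq_mul] at h
    refine h.trans_eq (Finset.sum_congr rfl fun k _ => ?_)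
    congr 1
    refine Finset.sum_congr rfl fun l _ => ?_
    change _ = V σ θ Ψ k l * x l
    rw [V_eq hσ hθ, bilin_comm (posDef_isSymm hpd), mul_comm]

/-- The minimizer over the linear model of the criterion linearized at `t`, when `E` is the
deviation of the empirical covariances and `u = unitZero - t`. -/
noncomputable def linearized (σ : ℝ) (θ : Param p) (Ψ : Fin d → Param p)
    (E : Matrix (Torus p) (Torus p) ℝ) (u : Param p) : Param p :=
  ∑ k, ((V σ θ Ψ)⁻¹ *ᵥ fun l => Ψ l ⬝ᵥ E *ᵥ u) k • Ψ k

theorem linearized_mem (hΨ : IsBasisOf Ψ S) (E : Matrix (Torus p) (Torus p) ℝ) (u : Param p) :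
    linearized σ θ Ψ E u ∈ S := by
  rw [← hΨ.2]
  exact Submodule.sum_mem _ fun k _ =>
    Submodule.smul_mem _ _ (Submodule.subset_span (Set.mem_range_self k))

theorem bilin_linearized (hσ : 0 < σ) (hθ : θ ∈ ThetaPlus p) (hΨ : IsBasisOf Ψ S)
    (E : Matrix (Torus p) (Torus p) ℝ) (u : Param p) {δ : Param p} (hδ : δ ∈ S) :
    δ ⬝ᵥ covMatrix σ θ *ᵥ linearized σ θ Ψ E u = δ ⬝ᵥ E *ᵥ u := by
  have hV : IsUnit (V σ θ Ψ).det := (isUnit_iff_isUnit_det _).1 (V_posDef hσ hθ hΨ.1).isUnit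
  rw [← hΨ.2] at hδ
  induction hδ using Submodule.span_induction with
  | mem x hx =>
    obtain ⟨l, rfl⟩ := hx
    have h := congrFun (mulVec_mulVec (fun l => Ψ l ⬝ᵥ E *ᵥ u) (V σ θ Ψ) (V σ θ Ψ)⁻¹) l
    rw [mul_nonsing_inv _ hV, one_mulVec] at h
    rw [← h, linearized, mulVec_sum, dotProduct_sum]
    conv_rhs => rw [mulVec, dotProduct]
    refine Finset.sum_congr rfl fun k _ => ?_
    rw [mulVec_smul, dotProduct_smul, smul_eq_mul, V_eq hσ hθ, mul_comm]
  | zero => simp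
  | add x y _ _ hx hy => rw [add_dotProduct, add_dotProduct, hx, hy]
  | smul c x _ hx => rw [smul_dotProduct, smul_dotProduct, hx]

theorem quad_linearized (hσ : 0 < σ) (hθ : θ ∈ ThetaPlus p) (hΨ : IsBasisOf Ψ S)
    (E : Matrix (Torus p) (Torus p) ℝ) (u : Param p) :
    linearized σ θ Ψ E u ⬝ᵥ covMatrix σ θ *ᵥ linearized σ θ Ψ E u =
      ∑ k, ∑ l, (V σ θ Ψ)⁻¹ k l * ((Ψ k ⬝ᵥ E *ᵥ u) * (Ψ l ⬝ᵥ E *ᵥ u)) := by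
  rw [bilin_linearized hσ hθ hΨ E u (linearized_mem hΨ E u)]
  conv_lhs => rw [linearized]
  rw [sum_dotProduct]
  refine Finset.sum_congr rfl fun k _ => ?_
  rw [smul_dotProduct, smul_eq_mul, mulVec, dotProduct, Finset.sum_mul]
  exact Finset.sum_congr rfl fun l _ => by ring

end Linearized

end GMRF

namespace GMRF

open Matrix

/-! ### Asymptotic risk of the estimator -/

section Asymptotics

theorem tendsto_of_forall_abs_sub_le {u : ℕ → ℝ} {b A : ℝ}
    (h : ∀ ε > 0, ∃ D : ℝ, ∀ n : ℕ, 1 ≤ n → |u n - b| ≤ ε * A + D / n) :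
    Tendsto u atTop (𝓝 b) := by
  rw [Metric.tendsto_atTop]
  intro η hη
  obtain ⟨D, hD⟩ := h (η / (2 * (|A| + 1))) (by positivity)
  have hlim : Tendsto (fun n : ℕ => D / (n : ℝ)) atTop (𝓝 0) :=
    tendsto_const_div_atTop_nhds_zero_nat D
  obtain ⟨N, hN⟩ := (Metric.tendsto_atTop.1 hlim) (η / 2) (by positivity)
  refine ⟨max N 1, fun n hn => ?_⟩
  have h1 := hD n ((le_max_right _ _).trans hn)
  have h2 := hN n ((le_max_left _ _).trans hn)
  rw [Real.dist_eq, sub_zero] at h2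
  rw [Real.dist_eq]
  have h3 : η / (2 * (|A| + 1)) * A ≤ η / 2 := by
    have : η / (2 * (|A| + 1)) * A = η / 2 * (A / (|A| + 1)) := by field_simp
    rw [this]
    refine mul_le_of_le_one_right (by positivity) ?_
    rw [div_le_one (by positivity)]
    linarith [le_abs_self A]
  linarith [le_abs_self (D / (n : ℝ))]

variable {p : ℕ} [NeZero p] {σ : ℝ} {θ : Param p} {S : Submodule ℝ (Param p)} {ρ : ℝ} {d : ℕ}
  {Ψ : Fin d → Param p} {Ω : Type*} {X : ℕ → Ω → Field p} {t : Param p}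

/-- The loss of the estimator is the squared norm of the linearized estimator, up to terms that
are small or of higher order in the deviation of the empirical covariances. -/
theorem exists_loss_bound (hS : S ≤ Theta p) (hρ : 1 < ρ) (hσ : 0 < σ) (hθ : θ ∈ ThetaPlus p)
    (ht : t ∈ admissible S ρ)
    (hopt : ∀ δ ∈ S, δ ⬝ᵥ covMatrix σ θ *ᵥ (unitZero p - t) = 0) (hΨ : IsBasisOf Ψ S) :
    ∃ a : ℝ, 0 ≤ a ∧ ∀ ε > 0, ∃ D : ℝ, 0 ≤ D ∧ ∀ (n : ℕ) (ω : Ω),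
      linearized σ θ Ψ (deviation σ θ X n ω) (unitZero p - t) ⬝ᵥ covMatrix σ θ *ᵥ
        linearized σ θ Ψ (deviation σ θ X n ω) (unitZero p - t) ≤
          a * frobSq (deviation σ θ X n ω) ∧
      |loss σ θ (estimator S ρ (fun i : Fin n => X i ω)) t -
        linearized σ θ Ψ (deviation σ θ X n ω) (unitZero p - t) ⬝ᵥ covMatrix σ θ *ᵥ
        linearized σ θ Ψ (deviation σ θ X n ω) (unitZero p - t)| ≤
        ε * frobSq (deviation σ θ X n ω) + D * frobSq (deviation σ θ X n ω) ^ 2 := by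
  have hKS : closure (admissible S ρ) ⊆ S := closure_admissible_subset
  obtain ⟨r, hr, hball⟩ := exists_ball_subset_admissible hS ht
  obtain ⟨a, ha, H⟩ := exists_perturbation_bound (covMatrix_posDef hσ hθ) hKS
    (fun y hy v => abs_le_one_of_mem_closure hy v) (subset_closure ht) hr
    (fun δ hδ hδr => subset_closure (hball δ hδ hδr)) hopt
  refine ⟨a, ha, fun ε hε => ?_⟩
  obtain ⟨D, hD, H'⟩ := H ε hε
  refine ⟨D, hD, fun n ω => ?_⟩
  set x : Fin n → Field p := fun i => X i ω
  have hspec := estimator_spec (S := S) hρ x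
  have h := H' (sampleGram x) (estimator S ρ x)
    (linearized σ θ Ψ (deviation σ θ X n ω) (unitZero p - t)) (sampleGram_isSymm x) hspec.1
    (fun z hz => by
      have h := hspec.2 hz
      simp only [Set.mem_ofPred_eq] at h
      rwa [clsCriterion_eq x (hS (hKS hspec.1)).1, clsCriterion_eq x (hS (hKS hz)).1] at h)
    (linearized_mem hΨ _ _) (fun δ hδ => bilin_linearized hσ hθ hΨ _ _ hδ)
  rw [loss_eq σ θ (hS (S.sub_mem (hKS hspec.1) ht.1))]
  exact h

variable [MeasurableSpace Ω] {P : Measure Ω}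

theorem trace_mul_symm {A B : Matrix (Fin d) (Fin d) ℝ} (hB : B.IsSymm) :
    ∑ k, ∑ l, B k l * A k l = (A * B).trace := by
  simp only [trace, diag_apply, mul_apply]
  refine Finset.sum_congr rfl fun k _ => Finset.sum_congr rfl fun l _ => ?_
  rw [mul_comm, hB.apply]

theorem integrable_quad_linearized (hσ : 0 < σ) (hθ : θ ∈ ThetaPlus p) (hΨ : IsBasisOf Ψ S)
    (hX : ∀ i, HasLaw (X i) (fieldLaw σ θ) P) {n : ℕ} (hn : 1 ≤ n) (u : Param p) :
    (∀ k l, Integrable (fun ω => (Ψ k ⬝ᵥ deviation σ θ X n ω *ᵥ u) *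
      (Ψ l ⬝ᵥ deviation σ θ X n ω *ᵥ u)) P) ∧
    Integrable (fun ω => linearized σ θ Ψ (deviation σ θ X n ω) u ⬝ᵥ covMatrix σ θ *ᵥ
      linearized σ θ Ψ (deviation σ θ X n ω) u) P := by
  have hm : ∀ k, HasMoments (fun ω => Ψ k ⬝ᵥ deviation σ θ X n ω *ᵥ u) P := fun k => by
    simp only [dotProduct, mulVec, Finset.mul_sum]
    exact hasMoments_sum _ fun v _ => hasMoments_sum _ fun w _ =>
      HasMoments.const_mul
        (by simpa only [mul_comm] using (hasMoments_deviation hX hn v w).const_mul _) _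
  refine ⟨fun k l => ((hm k).mul (hm l)).integrable, ?_⟩
  simp only [quad_linearized hσ hθ hΨ]
  exact integrable_finsetSum _ fun k _ => integrable_finsetSum _ fun l _ =>
    (((hm k).mul (hm l)).const_mul _).integrable

theorem integral_quad_linearized (hS : S ≤ Theta p) (hσ : 0 < σ) (hθ : θ ∈ ThetaPlus p)
    (hX : ∀ i, HasLaw (X i) (fieldLaw σ θ) P) (hind : iIndepFun X P)
    (ht : t ∈ Theta p) (hΨ : IsBasisOf Ψ S) {n : ℕ} (hn : 1 ≤ n) :
    ∫ ω, linearized σ θ Ψ (deviation σ θ X n ω) (unitZero p - t) ⬝ᵥ covMatrix σ θ *ᵥ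
      linearized σ θ Ψ (deviation σ θ X n ω) (unitZero p - t) ∂P =
      1 / (n * (p : ℝ) ^ 2) * (2 * σ ^ 4 * (W θ t Ψ * (V σ θ Ψ)⁻¹).trace) := by
  have hi := (integrable_quad_linearized hσ hθ hΨ hX hn (unitZero p - t)).1
  have hi' : ∀ k l, Integrable (fun ω => (V σ θ Ψ)⁻¹ k l *
      ((Ψ k ⬝ᵥ deviation σ θ X n ω *ᵥ (unitZero p - t)) *
        (Ψ l ⬝ᵥ deviation σ θ X n ω *ᵥ (unitZero p - t)))) P := fun k l => (hi k l).const_mul _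
  have hΨS : ∀ k, Ψ k ∈ Theta p := fun k => hS (by
    rw [← hΨ.2]; exact Submodule.subset_span (Set.mem_range_self k))
  simp only [quad_linearized hσ hθ hΨ]
  rw [integral_finsetSum _ fun k _ => integrable_finsetSum _ fun l _ => hi' k l]
  have h : ∀ k, ∫ ω, ∑ l, (V σ θ Ψ)⁻¹ k l *
      ((Ψ k ⬝ᵥ deviation σ θ X n ω *ᵥ (unitZero p - t)) *
        (Ψ l ⬝ᵥ deviation σ θ X n ω *ᵥ (unitZero p - t))) ∂P =
      1 / (n * (p : ℝ) ^ 2) * (2 * σ ^ 4 * ∑ l, (V σ θ Ψ)⁻¹ k l * W θ t Ψ k l) := fun k => by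
    rw [integral_finsetSum _ fun l _ => hi' k l, Finset.mul_sum, Finset.mul_sum]
    refine Finset.sum_congr rfl fun l _ => ?_
    rw [integral_const_mul, integral_bilin_deviation_mul hσ hθ hX hind ht hΨS hn]
    ring
  simp only [h, ← Finset.mul_sum]
  rw [trace_mul_symm (posDef_isSymm (V_posDef hσ hθ hΨ.1).inv)]

/-- Consistency of the estimator of a linear model and limit of its risk, when the limit point
`t` belongs to the interior of the parameter set. -/
theorem estimator_asymptotics [IsProbabilityMeasure P] (hS : S ≤ Theta p) (hρ : 1 < ρ)
    (hσ : 0 < σ) (hθ : θ ∈ ThetaPlus p)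
    (ht : t ∈ admissible S ρ)
    (hopt : ∀ δ ∈ S, δ ⬝ᵥ covMatrix σ θ *ᵥ (unitZero p - t) = 0) (hΨ : IsBasisOf Ψ S)
    (hX : ∀ i, HasLaw (X i) (fieldLaw σ θ) P) (hind : iIndepFun X P) :
    TendstoInMeasure P (fun (n : ℕ) ω => estimator S ρ (fun i : Fin n => X i ω)) atTop
      (fun _ => t) ∧
    (∀ n : ℕ, 1 ≤ n →
      Integrable (fun ω => loss σ θ (estimator S ρ (fun i : Fin n => X i ω)) t) P) ∧
    IsUnit (V σ θ Ψ).det ∧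
    Tendsto (fun n : ℕ => (n : ℝ) * (p : ℝ) ^ 2 *
        ∫ ω, loss σ θ (estimator S ρ (fun i : Fin n => X i ω)) t ∂P) atTop
      (𝓝 (2 * σ ^ 4 * (W θ t Ψ * (V σ θ Ψ)⁻¹).trace)) := by
  have hpd := covMatrix_posDef hσ hθ
  have hp : (0 : ℝ) < p := Nat.cast_pos.2 (NeZero.pos p)
  obtain ⟨a, ha, H⟩ := exists_loss_bound (X := X) hS hρ hσ hθ ht hopt hΨ
  set Q : ℕ → Ω → ℝ := fun n ω =>
    linearized σ θ Ψ (deviation σ θ X n ω) (unitZero p - t) ⬝ᵥ covMatrix σ θ *ᵥ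
      linearized σ θ Ψ (deviation σ θ X n ω) (unitZero p - t) with hQ
  set R : ℕ → Ω → ℝ := fun n ω => frobSq (deviation σ θ X n ω) with hR
  set ℓ : ℕ → Ω → ℝ := fun n ω => loss σ θ (estimator S ρ (fun i : Fin n => X i ω)) t with hℓ
  have hRi : ∀ n, 1 ≤ n → HasMoments (R n) P := fun n hn => hasMoments_frobSq_deviation hX hn
  have hQi : ∀ n, 1 ≤ n → Integrable (Q n) P := fun n hn =>
    (integrable_quad_linearized hσ hθ hΨ hX hn _).2
  have hℓm : ∀ n, 1 ≤ n → AEStronglyMeasurable (ℓ n) P := fun n hn =>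
    aestronglyMeasurable_estimator_comp hS hρ hσ hθ hX hn (loss_continuous σ θ t)
  have hdi : ∀ (ε D : ℝ) (n : ℕ), 1 ≤ n → Integrable (fun ω => ε * R n ω + D * R n ω ^ 2) P :=
    fun ε D n hn => ((hRi n hn).const_mul ε |>.add (((hRi n hn).pow 2).const_mul D)).integrable
  have hdiff : ∀ n, 1 ≤ n → Integrable (fun ω => ℓ n ω - Q n ω) P := fun n hn => by
    obtain ⟨D, hD, H'⟩ := H 1 one_pos
    exact (hdi 1 D n hn).mono' ((hℓm n hn).sub (hQi n hn).1)
      (Eventually.of_forall fun ω => (H' n ω).2)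
  have hint : ∀ n, 1 ≤ n → Integrable (ℓ n) P := fun n hn => by
    have h := (hdiff n hn).add (hQi n hn)
    refine h.congr (Eventually.of_forall fun ω => ?_)
    simp
  obtain ⟨A, hA, hAn⟩ := exists_integral_frobSq_le hσ hθ hX hind
  obtain ⟨B, hB, hBn⟩ := exists_integral_frobSq_sq_le hσ hθ hX hind
  have htΘ : t ∈ Theta p := hS ht.1
  have hlim : Tendsto (fun n : ℕ => (n : ℝ) * (p : ℝ) ^ 2 * ∫ ω, ℓ n ω ∂P) atTop
      (𝓝 (2 * σ ^ 4 * (W θ t Ψ * (V σ θ Ψ)⁻¹).trace)) := by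
    refine tendsto_of_forall_abs_sub_le (A := (p : ℝ) ^ 2 * A) fun ε hε => ?_
    obtain ⟨D, hD, H'⟩ := H ε hε
    refine ⟨(p : ℝ) ^ 2 * (D * B), fun n hn => ?_⟩
    have hn0 : (0 : ℝ) < n := by positivity
    have h1 := integral_quad_linearized hS hσ hθ hX hind htΘ hΨ hn
    have h2 : |∫ ω, (ℓ n ω - Q n ω) ∂P| ≤ ε * (A / n) + D * (B / (n : ℝ) ^ 2) := by
      refine (abs_integral_le_integral_abs).trans ?_
      refine (integral_mono (hdiff n hn).abs (hdi ε D n hn) fun ω => (H' n ω).2).trans ?_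
      rw [integral_add ((hRi n hn).const_mul ε).integrable
        (((hRi n hn).pow 2).const_mul D).integrable, integral_const_mul, integral_const_mul]
      exact add_le_add (mul_le_mul_of_nonneg_left (hAn n hn) hε.le)
        (mul_le_mul_of_nonneg_left (hBn n hn) hD)
    rw [integral_sub (hint n hn) (hQi n hn), h1] at h2
    have e : (n : ℝ) * (p : ℝ) ^ 2 * ∫ ω, ℓ n ω ∂P -
        2 * σ ^ 4 * (W θ t Ψ * (V σ θ Ψ)⁻¹).trace = (n : ℝ) * (p : ℝ) ^ 2 *
        (∫ ω, ℓ n ω ∂P -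
          1 / (n * (p : ℝ) ^ 2) * (2 * σ ^ 4 * (W θ t Ψ * (V σ θ Ψ)⁻¹).trace)) := by
      field_simp
    rw [e, abs_mul, abs_of_pos (by positivity)]
    refine (mul_le_mul_of_nonneg_left h2 (by positivity)).trans (le_of_eq ?_)
    field_simp
  refine ⟨?_, hint, (isUnit_iff_isUnit_det _).1 (V_posDef hσ hθ hΨ.1).isUnit, hlim⟩
  -- consistency: the risk tends to zero
  obtain ⟨c, hc, hcl⟩ := exists_lower_bound_of_posDef hpd
  have hℓ0 : Tendsto (fun n : ℕ => ∫ ω, ℓ n ω ∂P) atTop (𝓝 0) := by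
    have h1 := hlim.mul (tendsto_one_div_atTop_nhds_zero_nat.div_const ((p : ℝ) ^ 2))
    rw [zero_div, mul_zero] at h1
    refine h1.congr' ?_
    filter_upwards [eventually_ge_atTop 1] with n hn
    have hn0 : (0 : ℝ) < n := by positivity
    field_simp
  have hℓc : ∀ n ω, c * ((estimator S ρ (fun i : Fin n => X i ω) - t) ⬝ᵥ
      (estimator S ρ (fun i : Fin n => X i ω) - t)) ≤ ℓ n ω := fun n ω => by
    have hmem := closure_admissible_subset (estimator_spec (S := S) hρ (fun i : Fin n => X i ω)).1
    simp only [hℓ]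
    rw [loss_eq σ θ (hS (S.sub_mem hmem ht.1))]
    exact hcl _
  rw [tendstoInMeasure_iff_norm]
  intro ε hε
  have hub : ∀ n, 1 ≤ n → P {ω | ε ≤ ‖estimator S ρ (fun i : Fin n => X i ω) - t‖} ≤
      ENNReal.ofReal ((∫ ω, ℓ n ω ∂P) / (c * ε ^ 2)) := fun n hn => by
    have hsub : {ω | ε ≤ ‖estimator S ρ (fun i : Fin n => X i ω) - t‖} ⊆
        {ω | c * ε ^ 2 ≤ ℓ n ω} := fun ω hω => by
      refine le_trans (mul_le_mul_of_nonneg_left ?_ hc.le) (hℓc n ω)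
      set y := estimator S ρ (fun i : Fin n => X i ω) - t with hy
      by_contra hlt
      have hy' : ‖y‖ < ε := by
        rw [pi_norm_lt_iff hε]
        intro v
        rw [Real.norm_eq_abs]
        exact abs_lt_of_sq_lt_sq ((sq_le_dotProduct_self y v).trans_lt (not_le.1 hlt)) hε.le
      exact absurd hω (not_le.2 hy')
    have hmk := mul_meas_ge_le_integral_of_nonneg (μ := P) (f := ℓ n)
      (Eventually.of_forall fun ω =>
        (mul_nonneg hc.le (dotProduct_self_nonneg' _)).trans (hℓc n ω)) (hint n hn) (c * ε ^ 2)
    rw [← ofReal_measureReal]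
    refine ENNReal.ofReal_le_ofReal ?_
    rw [le_div_iff₀ (by positivity), mul_comm]
    exact (mul_le_mul_of_nonneg_left (measureReal_mono hsub) (by positivity)).trans hmk
  have hz : Tendsto (fun n : ℕ => ENNReal.ofReal ((∫ ω, ℓ n ω ∂P) / (c * ε ^ 2))) atTop (𝓝 0) := by
    have := ENNReal.tendsto_ofReal (hℓ0.div_const (c * ε ^ 2))
    simpa using this
  refine tendsto_of_tendsto_of_tendsto_of_le_of_le' tendsto_const_nhds hz
    (Eventually.of_forall fun _ => zero_le) ?_
  filter_upwards [eventually_ge_atTop 1] with n hn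
  exact hub n hn

end Asymptotics

end GMRF

namespace GMRF

open Matrix

/-! ### The isometries of the square -/

section Isometries

variable {p : ℕ}

theorem SquareIsometry.act_add (g : SquareIsometry) (v w : Torus p) :
    g.act (v + w) = g.act v + g.act w := by
  rcases g with ⟨_ | _, ε, ε'⟩ <;> ext <;> simp [SquareIsometry.act, mul_add]

theorem intUnit_mul_self_cast (ε : ℤˣ) (a : ZMod p) :
    ((ε : ℤ) : ZMod p) * (((ε : ℤ) : ZMod p) * a) = a := by
  rcases Int.units_eq_one_or ε with rfl | rfl <;> simp

theorem SquareIsometry.exists_act_act_eq (g : SquareIsometry) :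
    ∃ h : SquareIsometry, ∀ v : Torus p, h.act (g.act v) = v := by
  rcases g with ⟨_ | _, ε, ε'⟩
  · exact ⟨(false, ε, ε'), fun v => by ext <;> simp [SquareIsometry.act, intUnit_mul_self_cast]⟩
  · exact ⟨(true, ε', ε), fun v => by ext <;> simp [SquareIsometry.act, intUnit_mul_self_cast]⟩

theorem SquareIsometry.exists_act_eq_act_act (g h : SquareIsometry) :
    ∃ k : SquareIsometry, ∀ v : Torus p, k.act v = h.act (g.act v) := by
  rcases g with ⟨_ | _, ε, ε'⟩ <;> rcases h with ⟨_ | _, η, η'⟩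
  · exact ⟨(false, η * ε, η' * ε'), fun v => by ext <;> simp [SquareIsometry.act, mul_assoc]⟩
  · exact ⟨(true, η * ε', η' * ε), fun v => by ext <;> simp [SquareIsometry.act, mul_assoc]⟩
  · exact ⟨(true, η * ε, η' * ε'), fun v => by ext <;> simp [SquareIsometry.act, mul_assoc]⟩
  · exact ⟨(false, η * ε', η' * ε), fun v => by ext <;> simp [SquareIsometry.act, mul_assoc]⟩

/-- The central symmetry, as an isometry of the square. -/
def centralSymmetry : SquareIsometry := (false, -1, -1)

theorem centralSymmetry_act (v : Torus p) : centralSymmetry.act v = -v := by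
  ext <;> simp [centralSymmetry, SquareIsometry.act]

theorem act_zero (g : SquareIsometry) : g.act (0 : Torus p) = 0 := by
  ext <;> simp [SquareIsometry.act]

variable [NeZero p]

theorem SquareIsometry.act_bijective (g : SquareIsometry) :
    Function.Bijective (g.act : Torus p → Torus p) := by
  obtain ⟨h, hh⟩ := g.exists_act_act_eq (p := p)
  exact Finite.injective_iff_bijective.1 (Function.LeftInverse.injective hh)

/-- An isometry of the square as a permutation of the torus. -/
noncomputable def SquareIsometry.equiv (p : ℕ) [NeZero p] (g : SquareIsometry) :
    Torus p ≃ Torus p :=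
  Equiv.ofBijective g.act g.act_bijective

theorem min_val_intUnit_mul (ε : ℤˣ) (a : ZMod p) :
    min ((((ε : ℤ) : ZMod p)) * a).val (p - ((((ε : ℤ) : ZMod p)) * a).val) =
      min a.val (p - a.val) := by
  rcases Int.units_eq_one_or ε with rfl | rfl
  · simp
  · have ha := a.val_lt
    simp only [Units.val_neg, Units.val_one, Int.cast_neg, Int.cast_one, neg_mul, one_mul,
      ZMod.neg_val]
    split_ifs with h
    · simp [h]
    · rw [min_comm]
      congr 1
      omega

theorem toroidalNorm_act (g : SquareIsometry) (v : Torus p) :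
    toroidalNorm (g.act v) = toroidalNorm v := by
  rcases g with ⟨_ | _, ε, ε'⟩
  · simp only [toroidalNorm, SquareIsometry.act, min_val_intUnit_mul]
    simp
  · simp only [toroidalNorm, SquareIsometry.act, min_val_intUnit_mul]
    simp [add_comm]

theorem act_eq_zero_iff (g : SquareIsometry) (v : Torus p) : g.act v = 0 ↔ v = 0 :=
  ⟨fun h => (g.act_bijective (p := p)).injective (h.trans (act_zero g).symm),
    fun h => by rw [h, act_zero]⟩

theorem act_mem_iff_of_mem_models {m : Set (Torus p)} (hm : m ∈ models p) (g : SquareIsometry)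
    (v : Torus p) : g.act v ∈ m ↔ v ∈ m := by
  obtain ⟨r, -, rfl⟩ := hm
  simp [toroidalNorm_act, act_eq_zero_iff]

end Isometries

/-! ### The well specified model -/

section WellSpecified

variable {p : ℕ} [NeZero p] {σ : ℝ} {θ : Param p}

/-- The best linear prediction of the value at the origin from the other values has the
coefficients `θ`. -/
theorem bilin_unitZero_sub_self (hθ : θ ∈ ThetaPlus p) {δ : Param p} (hδ : δ 0 = 0) :
    δ ⬝ᵥ covMatrix σ θ *ᵥ (unitZero p - θ) = 0 := by
  have e : unitZero p - θ = (1 - C θ) *ᵥ Pi.single 0 1 := by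
    ext v
    rw [mulVec_single_one, col_apply, Matrix.sub_apply, one_apply]
    simp only [unitZero, Pi.sub_apply, Pi.single_apply, C, of_apply, zero_sub, ← hθ.1.2 v]
  have hu : IsUnit (1 - C θ).det := (isUnit_iff_isUnit_det _).1 hθ.2.isUnit
  rw [e, mulVec_mulVec, covMatrix, smul_mul_assoc, nonsing_inv_mul _ hu, smul_mulVec, one_mulVec,
    dotProduct_smul, dotProduct_single, hδ, zero_mul, smul_zero]

/-- At the true parameter the factors `(1 - C θ) ^ 2` and `(1 - C θ)⁻¹ ^ 2` of `W` cancel, and `W`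
is the Gram matrix of the family. -/
theorem W_self_eq_IL (hθ : θ ∈ ThetaPlus p) {d : ℕ} {Ψ : Fin d → Param p}
    (hΨ : ∀ k, Ψ k ∈ Theta p) (horth : ∀ k l, k ≠ l → Ψ k ⬝ᵥ Ψ l = 0) : W θ θ Ψ = IL Ψ := by
  have hu : IsUnit (1 - C θ).det := (isUnit_iff_isUnit_det _).1 hθ.2.isUnit
  have hp : (p : ℝ) ≠ 0 := Nat.cast_ne_zero.2 (NeZero.ne p)
  have e : (1 - C θ) ^ 2 * ((1 - C θ)⁻¹) ^ 2 = 1 := by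
    rw [sq, sq, mul_assoc, ← mul_assoc _ (1 - C θ)⁻¹, mul_nonsing_inv _ hu, one_mul,
      mul_nonsing_inv _ hu]
  have hst : Stationary (1 : Matrix (Torus p) (Torus p) ℝ) := fun j v w => by simp [one_apply]
  ext k l
  rw [W, of_apply, mul_assoc (C (Ψ k)), e, trace_C_mul_C _ (hΨ l).2 hst, one_mulVec, IL,
    diagonal_apply]
  split_ifs with h
  · subst h
    simp only [dotProduct, sq]
    field_simp
  · rw [horth k l h, mul_zero, mul_zero]

theorem Psi_dotProduct_eq_zero {v v' : Torus p} (h : Psi v ≠ Psi v') : Psi v ⬝ᵥ Psi v' = 0 := by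
  refine Finset.sum_eq_zero fun w _ => ?_
  simp only [Psi]
  split_ifs with h1 h2 <;> try simp
  refine h (funext fun u => ?_)
  have : (u = v ∨ u = -v) ↔ (u = v' ∨ u = -v') := by
    rcases h1 with rfl | rfl <;> rcases h2 with h2 | h2
    · rw [h2]
    · rw [h2, neg_neg, or_comm]
    · rw [← h2, neg_neg, or_comm]
    · rw [neg_inj.1 h2]
  simp only [Psi, this]

/-- Two orbits of the isometries of the square are equal or disjoint. -/
theorem PsiIso_dotProduct_eq_zero {v v' : Torus p} (h : PsiIso v ≠ PsiIso v') :
    PsiIso v ⬝ᵥ PsiIso v' = 0 := by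
  have key : ∀ a b u : Torus p, (∃ g : SquareIsometry, b = g.act a) →
      (∃ g : SquareIsometry, u = g.act a) → ∃ g : SquareIsometry, u = g.act b := by
    rintro a b u ⟨g, rfl⟩ ⟨k, rfl⟩
    obtain ⟨g', hg'⟩ := g.exists_act_act_eq (p := p)
    obtain ⟨q, hq⟩ := g'.exists_act_eq_act_act (p := p) k
    exact ⟨q, by rw [hq, hg']⟩
  have hsym : ∀ a b : Torus p, (∃ g : SquareIsometry, b = g.act a) →
      ∃ g : SquareIsometry, a = g.act b := by
    rintro a b ⟨g, rfl⟩
    obtain ⟨g', hg'⟩ := g.exists_act_act_eq (p := p)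
    exact ⟨g', (hg' a).symm⟩
  refine Finset.sum_eq_zero fun w _ => ?_
  simp only [PsiIso]
  split_ifs with h1 h2 <;> try simp
  refine h (funext fun u => ?_)
  have : (∃ g : SquareIsometry, u = g.act v) ↔ ∃ g : SquareIsometry, u = g.act v' :=
    ⟨fun hu => key _ _ _ (hsym _ _ h2) (key _ _ _ h1 hu),
      fun hu => key _ _ _ (hsym _ _ h1) (key _ _ _ h2 hu)⟩
  simp only [PsiIso, this]

end WellSpecified

/-! ### Linear prediction from a neighbourhood -/

section Regression

variable {p : ℕ} [NeZero p] {σ : ℝ} {θ : Param p}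

/-- A positive definite system restricted to the coordinates in `m` has a solution. -/
theorem exists_supported_mulVec_eq {ι : Type*} [Fintype ι] {A : Matrix ι ι ℝ} (hA : A.PosDef)
    (m : Set ι) (b : ι → ℝ) :
    ∃ w : ι → ℝ, (∀ v, v ∉ m → w v = 0) ∧ ∀ v ∈ m, (A *ᵥ w) v = b v := by
  classical
  let T : (ι → ℝ) →ₗ[ℝ] (ι → ℝ) :=
    { toFun := fun w v => if v ∈ m then (A *ᵥ w) v else w v
      map_add' := fun w w' => by
        ext v
        by_cases h : v ∈ m <;> simp [h, mulVec_add]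
      map_smul' := fun c w => by
        ext v
        by_cases h : v ∈ m <;> simp [h, mulVec_smul] }
  have hT : ∀ w v, T w v = if v ∈ m then (A *ᵥ w) v else w v := fun _ _ => rfl
  have hinj : Function.Injective T := by
    rw [← LinearMap.ker_eq_bot, LinearMap.ker_eq_bot']
    intro w hw
    by_contra hne
    refine (posDef_quad_pos hA hne).ne' (Finset.sum_eq_zero fun v _ => ?_)
    have h := congrFun hw v
    rw [hT] at h
    split_ifs at h with hv
    · simp [h]
    · simp [h]
  obtain ⟨w, hw⟩ := LinearMap.injective_iff_surjective.1 hinj (fun v => if v ∈ m then b v else 0)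
  refine ⟨w, fun v hv => ?_, fun v hv => ?_⟩
  · have h := congrFun hw v
    simpa [hT, hv] using h
  · have h := congrFun hw v
    simpa [hT, hv] using h

theorem one_sub_C_mulVec_covMatrix (hθ : θ ∈ ThetaPlus p) (w : Param p) :
    (1 - C θ) *ᵥ (covMatrix σ θ *ᵥ w) = σ ^ 2 • w := by
  have hu : IsUnit (1 - C θ).det := (isUnit_iff_isUnit_det _).1 hθ.2.isUnit
  rw [mulVec_mulVec, covMatrix, mul_smul_comm, mul_nonsing_inv _ hu, smul_mulVec, one_mulVec]

/-- The coefficients of the best linear prediction of the value at the origin from the values in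
`m`. Their `ℓ¹` norm is the value at the origin of a function `h` that is at most one in absolute
value on `m` and satisfies `h v = ∑ θ l * h (v + l)` off `m`; since `‖θ‖₁ < 1`, such a function
obeys a maximum principle. -/
theorem exists_regression (hσ : 0 < σ) (hθ : θ ∈ ThetaPlus p) (hl : l1norm θ < 1)
    {m : Set (Torus p)} (h0 : (0 : Torus p) ∉ m) :
    ∃ t : Param p, (∀ v, v ∉ m → t v = 0) ∧
      (∀ δ : Param p, (∀ v, v ∉ m → δ v = 0) →
        δ ⬝ᵥ covMatrix σ θ *ᵥ (unitZero p - t) = 0) ∧ l1norm t < 1 := by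
  have hpd := covMatrix_posDef hσ hθ
  have hsym := posDef_isSymm hpd
  obtain ⟨t, htm, ht⟩ := exists_supported_mulVec_eq hpd m (covMatrix σ θ *ᵥ unitZero p)
  have hopt : ∀ δ : Param p, (∀ v, v ∉ m → δ v = 0) →
      δ ⬝ᵥ covMatrix σ θ *ᵥ (unitZero p - t) = 0 := fun δ hδ => by
    refine Finset.sum_eq_zero fun v _ => ?_
    by_cases hv : v ∈ m
    · rw [mulVec_sub, Pi.sub_apply, ht v hv, sub_self, mul_zero]
    · rw [hδ v hv, zero_mul]
  refine ⟨t, htm, hopt, ?_⟩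
  obtain ⟨w, hwm, hw⟩ := exists_supported_mulVec_eq hpd m (fun v => SignType.sign (t v))
  set h := covMatrix σ θ *ᵥ w with hh
  have hharm : ∀ v, v ∉ m → h v = ∑ l, θ l * h (v + l) := fun v hv => by
    have e := congrFun (one_sub_C_mulVec_covMatrix (σ := σ) hθ w) v
    rw [← hh, sub_mulVec, one_mulVec, Pi.sub_apply, C_mulVec, Pi.smul_apply, hwm v hv,
      smul_zero] at e
    linarith
  have hbound : ∀ (c : ℝ) (v : Torus p), (∀ u, |h u| ≤ c) → v ∉ m → |h v| ≤ l1norm θ * c :=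
    fun c v hc hv => by
      rw [hharm v hv, l1norm, Finset.sum_mul]
      refine (Finset.abs_sum_le_sum_abs _ _).trans (Finset.sum_le_sum fun l _ => ?_)
      rw [abs_mul]
      exact mul_le_mul_of_nonneg_left (hc _) (abs_nonneg _)
  -- a maximum of `|h|` off `m` is at most `‖θ‖₁` times itself, hence zero
  obtain ⟨v₀, hv₀⟩ := Finite.exists_max fun v => |h v|
  have hone : ∀ v, |h v| ≤ 1 := by
    have hle : |h v₀| ≤ 1 := by
      by_cases hm : v₀ ∈ m
      · rw [hw v₀ hm]
        rcases lt_trichotomy (t v₀) 0 with h' | h' | h' <;> simp [h']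
      · have := hbound _ v₀ hv₀ hm
        nlinarith [abs_nonneg (h v₀)]
    exact fun v => (hv₀ v).trans hle
  have hval : l1norm t = h 0 := by
    have e1 : l1norm t = t ⬝ᵥ h := by
      refine Finset.sum_congr rfl fun v _ => ?_
      by_cases hv : v ∈ m
      · rw [hw v hv, self_mul_sign]
      · rw [htm v hv, abs_zero, zero_mul]
    have e2 := hopt w hwm
    rw [mulVec_sub, dotProduct_sub, bilin_comm hsym w, bilin_comm hsym w t, ← hh, unitZero,
      single_one_dotProduct, sub_eq_zero] at e2
    rw [e1, ← e2]
  rw [hval]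
  have := hbound 1 0 hone h0
  linarith [le_abs_self (h 0)]

/-- The coefficients of the best linear prediction inherit the symmetries of `θ` and `m`. -/
theorem regression_apply_act (hσ : 0 < σ) (hθ : θ ∈ ThetaPlus p) {m : Set (Torus p)}
    {t : Param p} (htm : ∀ v, v ∉ m → t v = 0)
    (hopt : ∀ δ : Param p, (∀ v, v ∉ m → δ v = 0) →
      δ ⬝ᵥ covMatrix σ θ *ᵥ (unitZero p - t) = 0) {g : SquareIsometry}
    (hgθ : ∀ v, θ v = θ (g.act v)) (hgm : ∀ v, g.act v ∈ m ↔ v ∈ m) (v : Torus p) :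
    t v = t (g.act v) := by
  have hpd := covMatrix_posDef hσ hθ
  set T := g.equiv p with hT
  have hTa : ∀ v, T v = g.act v := fun _ => rfl
  have hM : (1 - C θ).submatrix T T = 1 - C θ := by
    ext a b
    have h1 : g.act b - g.act a = g.act (b - a) := by
      rw [sub_eq_iff_eq_add, ← g.act_add, sub_add_cancel]
    simp only [submatrix_apply, Matrix.sub_apply, one_apply, C, of_apply, hTa, h1, ← hgθ,
      (g.act_bijective (p := p)).injective.eq_iff]
  have hS : (covMatrix σ θ).submatrix T T = covMatrix σ θ := by
    have h := inv_submatrix_equiv (1 - C θ) T T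
    rw [hM] at h
    simp only [covMatrix, submatrix_smul, Pi.smul_apply]
    rw [← h]
  have hbil : ∀ a b : Param p, (a ∘ T) ⬝ᵥ covMatrix σ θ *ᵥ (b ∘ T) =
      a ⬝ᵥ covMatrix σ θ *ᵥ b := fun a b => by
    conv_lhs => rw [← hS, submatrix_mulVec_equiv, Function.comp_assoc, Equiv.self_comp_symm,
      Function.comp_id]
    exact comp_equiv_dotProduct_comp_equiv a _ T
  have he : unitZero p ∘ T = unitZero p := by
    ext u
    simp only [Function.comp_apply, unitZero, Pi.single_apply, hTa, act_eq_zero_iff]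
  set δ : Param p := t - t ∘ T with hδ
  have hδm : ∀ v, v ∉ m → δ v = 0 := fun v hv => by
    have h2 : T v ∉ m := fun h => hv ((hgm v).1 h)
    simp [hδ, htm v hv, htm _ h2]
  have h1 := hopt δ hδm
  have h2 : δ ⬝ᵥ covMatrix σ θ *ᵥ (unitZero p - t ∘ T) = 0 := by
    have e1 : δ = (δ ∘ T.symm) ∘ T := by ext u; simp
    have e2 : unitZero p - t ∘ T = (unitZero p - t) ∘ T := by
      rw [Pi.sub_comp, he]
    rw [e1, e2, hbil]
    refine hopt _ fun u hu => hδm _ fun h => hu ?_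
    have := (hgm (T.symm u)).2 h
    rwa [← hTa, Equiv.apply_symm_apply] at this
  have h3 : δ ⬝ᵥ covMatrix σ θ *ᵥ δ = 0 := by
    have e : δ = (unitZero p - t ∘ T) - (unitZero p - t) := by rw [hδ]; abel
    conv_lhs => rw [e, mulVec_sub, dotProduct_sub, ← e, h1, h2, sub_zero]
  have h4 : δ = 0 := by
    by_contra hne
    exact (posDef_quad_pos hpd hne).ne' h3
  have := congrFun h4 v
  simp only [hδ, Pi.sub_apply, Function.comp_apply, Pi.zero_apply, hTa] at this
  linarith

theorem abs_quad_C_le (t : Param p) (x : Torus p → ℝ) :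
    |x ⬝ᵥ C t *ᵥ x| ≤ l1norm t * (x ⬝ᵥ x) := by
  have e : x ⬝ᵥ C t *ᵥ x = ∑ v, t v * ∑ j, x j * x (j + v) := by
    simp only [dotProduct, C_mulVec, Finset.mul_sum]
    rw [Finset.sum_comm]
    exact Finset.sum_congr rfl fun v _ => Finset.sum_congr rfl fun j _ => by ring
  rw [e, l1norm, Finset.sum_mul]
  refine (Finset.abs_sum_le_sum_abs _ _).trans (Finset.sum_le_sum fun v _ => ?_)
  rw [abs_mul]
  refine mul_le_mul_of_nonneg_left ?_ (abs_nonneg _)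
  have h1 := dotProduct_sq_le x (fun j => x (j + v))
  have h2 : (fun j => x (j + v)) ⬝ᵥ (fun j => x (j + v)) = x ⬝ᵥ x :=
    Fintype.sum_equiv (Equiv.addRight v) _ _ fun _ => rfl
  rw [h2, ← sq] at h1
  exact abs_le_of_sq_le_sq h1 (dotProduct_self_nonneg' x)

/-- The eigenvalues of `1 - C t` are within `‖t‖₁` of one, hence between zero and two. -/
theorem mem_admissible_of_l1norm_lt {S : Submodule ℝ (Param p)} (hS : S ≤ Theta p) {ρ : ℝ}
    (hρ : 2 ≤ ρ) {t : Param p} (htS : t ∈ S) (ht : l1norm t < 1) : t ∈ admissible S ρ := by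
  have hsym : (C t).IsSymm := C_isSymm (hS htS).2
  have h1 : (1 : Matrix (Torus p) (Torus p) ℝ).IsSymm := transpose_one
  have hx0 : ∀ x : Torus p → ℝ, x ≠ 0 → 0 < x ⬝ᵥ x := fun x hx =>
    (dotProduct_self_nonneg' x).lt_of_ne fun h => hx (dotProduct_self_eq_zero.1 h.symm)
  rw [mem_admissible_iff hS]
  refine ⟨htS, posDef_of_quad_pos (h1.sub hsym) fun x hx => ?_,
    posDef_of_quad_pos ?_ fun x hx => ?_⟩
  · rw [sub_mulVec, one_mulVec, dotProduct_sub]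
    have i1 := (abs_le.1 (abs_quad_C_le t x)).2
    nlinarith [hx0 x hx]
  · rw [Algebra.algebraMap_eq_smul_one]
    exact (h1.smul ρ).sub (h1.sub hsym)
  · rw [Algebra.algebraMap_eq_smul_one, sub_mulVec, sub_mulVec, smul_mulVec, one_mulVec,
      dotProduct_sub, dotProduct_sub, dotProduct_smul, smul_eq_mul]
    have i1 := (abs_le.1 (abs_quad_C_le t x)).1
    nlinarith [hx0 x hx]

/-- An admissible parameter at which the gradient of the loss vanishes is the projection of `θ`. -/
theorem argminOn_loss_eq {S : Submodule ℝ (Param p)} (hS : S ≤ Theta p) {ρ : ℝ} (hρ : 1 < ρ)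
    (hσ : 0 < σ) (hθ : θ ∈ ThetaPlus p) {t : Param p} (ht : t ∈ admissible S ρ)
    (hopt : ∀ δ ∈ S, δ ⬝ᵥ covMatrix σ θ *ᵥ (unitZero p - t) = 0) :
    argminOn (fun θ' => loss σ θ θ' θ) (closure (admissible S ρ)) = t := by
  have hpd := covMatrix_posDef hσ hθ
  obtain ⟨hmem, hmin⟩ := argminOn_spec (loss_continuous σ θ θ)
    (isCompact_closure_admissible (S := S) (ρ := ρ)) (nonempty_closure_admissible hρ)
  set y := argminOn (fun θ' => loss σ θ θ' θ) (closure (admissible S ρ))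
  have hyS := closure_admissible_subset hmem
  have h := hmin (subset_closure ht)
  simp only [Set.mem_ofPred_eq] at h
  rw [loss_eq σ θ ((Theta p).sub_mem (hS hyS) hθ.1),
    loss_eq σ θ ((Theta p).sub_mem (hS ht.1) hθ.1)] at h
  have hδS : y - t ∈ S := S.sub_mem hyS ht.1
  have e : y - θ = (t - θ) + (y - t) := by abel
  have hz : (y - t) ⬝ᵥ covMatrix σ θ *ᵥ (t - θ) = 0 := by
    have e2 : t - θ = (unitZero p - θ) - (unitZero p - t) := by abel
    rw [e2, mulVec_sub, dotProduct_sub, hopt _ hδS,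
      bilin_unitZero_sub_self hθ (hS hδS).1, sub_zero]
  rw [e, quad_add (posDef_isSymm hpd), hz] at h
  by_contra hne
  have := posDef_quad_pos hpd (sub_ne_zero.2 hne)
  linarith

end Regression

end GMRF

namespace GMRF

open Matrix

/-! ### Well specified and misspecified models -/

section Models

variable {p : ℕ} [NeZero p] {σ ρ : ℝ} {θ : Param p} {S : Submodule ℝ (Param p)} {d : ℕ}
  {Ψ : Fin d → Param p} {Ω : Type*} [MeasurableSpace Ω] {P : Measure Ω}
  {X : ℕ → Ω → Field p}

/-- When the model contains the true parameter, the limit point is `θ` and `W` is diagonal. -/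
theorem estimator_asymptotics_of_mem [IsProbabilityMeasure P] (hS : S ≤ Theta p) (hρ : 1 < ρ)
    (hσ : 0 < σ) (hθ : θ ∈ ThetaPlus p) (hθS : θ ∈ S) (hmax : maxEigenvalue (1 - C θ) < ρ)
    (hΨ : IsBasisOf Ψ S) (horth : ∀ k l, Ψ k ≠ Ψ l → Ψ k ⬝ᵥ Ψ l = 0)
    (hX : ∀ i, HasLaw (X i) (fieldLaw σ θ) P) (hind : iIndepFun X P) :
    TendstoInMeasure P (fun (n : ℕ) ω => estimator S ρ (fun i : Fin n => X i ω)) atTop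
      (fun _ => θ) ∧
    (∀ n : ℕ, 1 ≤ n →
      Integrable (fun ω => loss σ θ (estimator S ρ (fun i : Fin n => X i ω)) θ) P) ∧
    IsUnit (V σ θ Ψ).det ∧
    Tendsto (fun n : ℕ => (n : ℝ) * (p : ℝ) ^ 2 *
        ∫ ω, loss σ θ (estimator S ρ (fun i : Fin n => X i ω)) θ ∂P) atTop
      (𝓝 (2 * σ ^ 4 * (IL Ψ * (V σ θ Ψ)⁻¹).trace)) := by
  rw [← W_self_eq_IL hθ
    (fun k => hS (hΨ.2 ▸ Submodule.subset_span (Set.mem_range_self k)))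
    (fun k l hkl => horth k l (hΨ.1.injective.ne hkl))]
  exact estimator_asymptotics hS hρ hσ hθ ⟨hθS, hθ, hmax⟩
    (fun δ hδ => bilin_unitZero_sub_self hθ (hS hδ).1) hΨ hX hind

/-- When the model may be wrong but `‖θ‖₁ < 1`, the projection of `θ` is the best linear prediction
from the nodes of `m`, which is an interior point of the parameter set. The hypothesis `hmS` says
that `S` contains the arrays supported in `m` that share all the symmetries common to `θ` and
`m`. -/
theorem estimator_asymptotics_of_l1norm_lt [IsProbabilityMeasure P] (hS : S ≤ Theta p)
    (hρ : 2 ≤ ρ) (hσ : 0 < σ) (hθ : θ ∈ ThetaPlus p) (hl : l1norm θ < 1) {m : Set (Torus p)}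
    (h0 : (0 : Torus p) ∉ m) (hSm : ∀ δ ∈ S, ∀ v, v ∉ m → δ v = 0)
    (hmS : ∀ t : Param p, (∀ v, v ∉ m → t v = 0) →
      (∀ g : SquareIsometry, (∀ v, θ v = θ (g.act v)) → (∀ v : Torus p, g.act v ∈ m ↔ v ∈ m) →
        ∀ v, t v = t (g.act v)) → t ∈ S)
    (hΨ : IsBasisOf Ψ S) (hX : ∀ i, HasLaw (X i) (fieldLaw σ θ) P) (hind : iIndepFun X P) :
    TendstoInMeasure P (fun (n : ℕ) ω => estimator S ρ (fun i : Fin n => X i ω)) atTop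
      (fun _ => argminOn (fun θ' => loss σ θ θ' θ) (closure (admissible S ρ))) ∧
    (∀ n : ℕ, 1 ≤ n →
      Integrable (fun ω => loss σ θ (estimator S ρ (fun i : Fin n => X i ω))
        (argminOn (fun θ' => loss σ θ θ' θ) (closure (admissible S ρ)))) P) ∧
    IsUnit (V σ θ Ψ).det ∧
    Tendsto (fun n : ℕ => (n : ℝ) * (p : ℝ) ^ 2 *
        ∫ ω, loss σ θ (estimator S ρ (fun i : Fin n => X i ω))
          (argminOn (fun θ' => loss σ θ θ' θ) (closure (admissible S ρ))) ∂P) atTop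
      (𝓝 (2 * σ ^ 4 *
        (W θ (argminOn (fun θ' => loss σ θ θ' θ) (closure (admissible S ρ))) Ψ *
          (V σ θ Ψ)⁻¹).trace)) := by
  obtain ⟨t, htm, hopt, ht⟩ := exists_regression hσ hθ hl h0
  have htS : t ∈ S := hmS t htm fun g hgθ hgm => regression_apply_act hσ hθ htm hopt hgθ hgm
  have hadm := mem_admissible_of_l1norm_lt hS hρ htS ht
  have hoptS : ∀ δ ∈ S, δ ⬝ᵥ covMatrix σ θ *ᵥ (unitZero p - t) = 0 :=
    fun δ hδ => hopt δ (hSm δ hδ)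
  have hρ' : 1 < ρ := by linarith
  rw [argminOn_loss_eq hS hρ' hσ hθ hadm hoptS]
  exact estimator_asymptotics hS hρ' hσ hθ hadm hoptS hΨ hX hind

end Models

end GMRF

theorem mainTheorem4 (p : ℕ) [NeZero p] (ρ₁ : ℝ) (hρ₁ : 2 ≤ ρ₁) (σ : ℝ) (hσ : 0 < σ)
    (m : Set (GMRF.Torus p)) (hm : m ∈ GMRF.models p) (hne : m.Nonempty)
    (θ : GMRF.Param p) (hθ : θ ∈ GMRF.ThetaPlus p)
    {Ω : Type*} [MeasurableSpace Ω] (P : Measure Ω) [IsProbabilityMeasure P]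
    (X : ℕ → Ω → GMRF.Field p) (hX : ∀ i, HasLaw (X i) (GMRF.fieldLaw σ θ) P)
    (hindep : iIndepFun X P) :
    -- the general estimator
    (∀ (d : ℕ) (s : Fin d → GMRF.Torus p),
      GMRF.IsBasisOf (fun k => GMRF.Psi (s k)) (GMRF.ThetaM m) →
      ((θ ∈ GMRF.ThetaM m → GMRF.maxEigenvalue (1 - GMRF.C θ) < ρ₁ →
        TendstoInMeasure P
          (fun (n : ℕ) ω => GMRF.clsEstimator m ρ₁ (fun i : Fin n => X i ω)) atTop (fun _ => θ) ∧
        (∀ n : ℕ, 1 ≤ n → Integrable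
          (fun ω => GMRF.loss σ θ (GMRF.clsEstimator m ρ₁ (fun i : Fin n => X i ω)) θ) P) ∧
        IsUnit (GMRF.V σ θ (fun k => GMRF.Psi (s k))).det ∧
        Tendsto (fun n : ℕ => (n : ℝ) * (p : ℝ) ^ 2 *
            ∫ ω, GMRF.loss σ θ (GMRF.clsEstimator m ρ₁ (fun i : Fin n => X i ω)) θ ∂P) atTop
          (𝓝 (2 * σ ^ 4 * (GMRF.IL (fun k => GMRF.Psi (s k)) *
            (GMRF.V σ θ (fun k => GMRF.Psi (s k)))⁻¹).trace))) ∧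
      (GMRF.l1norm θ < 1 →
        TendstoInMeasure P
          (fun (n : ℕ) ω => GMRF.clsEstimator m ρ₁ (fun i : Fin n => X i ω)) atTop
          (fun _ => GMRF.projection σ θ m ρ₁) ∧
        (∀ n : ℕ, 1 ≤ n → Integrable
          (fun ω => GMRF.loss σ θ (GMRF.clsEstimator m ρ₁ (fun i : Fin n => X i ω))
            (GMRF.projection σ θ m ρ₁)) P) ∧
        IsUnit (GMRF.V σ θ (fun k => GMRF.Psi (s k))).det ∧
        Tendsto (fun n : ℕ => (n : ℝ) * (p : ℝ) ^ 2 *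
            ∫ ω, GMRF.loss σ θ (GMRF.clsEstimator m ρ₁ (fun i : Fin n => X i ω))
              (GMRF.projection σ θ m ρ₁) ∂P) atTop
          (𝓝 (2 * σ ^ 4 * (GMRF.W θ (GMRF.projection σ θ m ρ₁) (fun k => GMRF.Psi (s k)) *
            (GMRF.V σ θ (fun k => GMRF.Psi (s k)))⁻¹).trace))))) ∧
    -- the isotropic estimator
    (θ ∈ GMRF.ThetaIso p → ∀ (d : ℕ) (s : Fin d → GMRF.Torus p),
      GMRF.IsBasisOf (fun k => GMRF.PsiIso (s k)) (GMRF.ThetaMIso m) →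
      ((θ ∈ GMRF.ThetaM m → GMRF.maxEigenvalue (1 - GMRF.C θ) < ρ₁ →
        TendstoInMeasure P
          (fun (n : ℕ) ω => GMRF.clsEstimatorIso m ρ₁ (fun i : Fin n => X i ω)) atTop
          (fun _ => θ) ∧
        (∀ n : ℕ, 1 ≤ n → Integrable
          (fun ω => GMRF.loss σ θ (GMRF.clsEstimatorIso m ρ₁ (fun i : Fin n => X i ω)) θ) P) ∧
        IsUnit (GMRF.V σ θ (fun k => GMRF.PsiIso (s k))).det ∧
        Tendsto (fun n : ℕ => (n : ℝ) * (p : ℝ) ^ 2 *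
            ∫ ω, GMRF.loss σ θ (GMRF.clsEstimatorIso m ρ₁ (fun i : Fin n => X i ω)) θ ∂P) atTop
          (𝓝 (2 * σ ^ 4 * (GMRF.IL (fun k => GMRF.PsiIso (s k)) *
            (GMRF.V σ θ (fun k => GMRF.PsiIso (s k)))⁻¹).trace))) ∧
      (GMRF.l1norm θ < 1 →
        TendstoInMeasure P
          (fun (n : ℕ) ω => GMRF.clsEstimatorIso m ρ₁ (fun i : Fin n => X i ω)) atTop
          (fun _ => GMRF.projectionIso σ θ m ρ₁) ∧
        (∀ n : ℕ, 1 ≤ n → Integrable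
          (fun ω => GMRF.loss σ θ (GMRF.clsEstimatorIso m ρ₁ (fun i : Fin n => X i ω))
            (GMRF.projectionIso σ θ m ρ₁)) P) ∧
        IsUnit (GMRF.V σ θ (fun k => GMRF.PsiIso (s k))).det ∧
        Tendsto (fun n : ℕ => (n : ℝ) * (p : ℝ) ^ 2 *
            ∫ ω, GMRF.loss σ θ (GMRF.clsEstimatorIso m ρ₁ (fun i : Fin n => X i ω))
              (GMRF.projectionIso σ θ m ρ₁) ∂P) atTop
          (𝓝 (2 * σ ^ 4 * (GMRF.W θ (GMRF.projectionIso σ θ m ρ₁) (fun k => GMRF.PsiIso (s k)) *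
            (GMRF.V σ θ (fun k => GMRF.PsiIso (s k)))⁻¹).trace))))) := by
  have hρ : 1 < ρ₁ := by linarith
  have h0 : (0 : GMRF.Torus p) ∉ m := by
    obtain ⟨r, -, rfl⟩ := hm
    exact fun h => h.1 rfl
  -- invariance under the central symmetry is the condition `t v = t (-v)` of `Θ`
  have hmem : ∀ t : GMRF.Param p, (∀ v, v ∉ m → t v = 0) →
      (∀ g : GMRF.SquareIsometry, (∀ v, θ v = θ (g.act v)) →
        (∀ v : GMRF.Torus p, g.act v ∈ m ↔ v ∈ m) → ∀ v, t v = t (g.act v)) →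
      t ∈ GMRF.ThetaM m := fun t htm hinv =>
    ⟨⟨htm 0 h0, fun v => by
      rw [← GMRF.centralSymmetry_act]
      refine hinv _ (fun v => ?_) (GMRF.act_mem_iff_of_mem_models hm _) v
      rw [GMRF.centralSymmetry_act]
      exact hθ.1.2 v⟩, htm⟩
  refine ⟨fun d s hΨ => ⟨fun hθm hmax => ?_, fun hl => ?_⟩,
    fun hiso d s hΨ => ⟨fun hθm hmax => ?_, fun hl => ?_⟩⟩
  · exact GMRF.estimator_asymptotics_of_mem (fun _ h => h.1) hρ hσ hθ hθm hmax hΨ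
      (fun _ _ => GMRF.Psi_dotProduct_eq_zero) hX hindep
  · exact GMRF.estimator_asymptotics_of_l1norm_lt (fun _ h => h.1) hρ₁ hσ hθ hl h0
      (fun _ h => h.2) hmem hΨ hX hindep
  · exact GMRF.estimator_asymptotics_of_mem (fun _ h => h.1.1) hρ hσ hθ ⟨hθm, hiso⟩ hmax hΨ
      (fun _ _ => GMRF.PsiIso_dotProduct_eq_zero) hX hindep
  · refine GMRF.estimator_asymptotics_of_l1norm_lt (fun _ h => h.1.1) hρ₁ hσ hθ hl h0
      (fun _ h => h.1.2) (fun t htm hinv => ?_) hΨ hX hindep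
    have htm' := hmem t htm hinv
    exact ⟨htm', htm'.1, fun g v =>
      hinv g (hiso.2 g) (GMRF.act_mem_iff_of_mem_models hm g) v⟩
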